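/- Let $L>0$ and $\mathbb T=\mathbb R/L\mathbb Z$, and write $\langle x\rangle=1+|x|$. For a function (or tempered distribution) $u$ on $\mathbb R\times\mathbb T$, with variables $(t,x)$, let $$\widehat u(\tau,n)=\frac{1}{(2\pi)^{1/2}L}\int_{\mathbb R\times[0,L]}u(t,x)\,e^{-i(2\pi nx/L+t\tau)}\,dt\,dx\qquad(\tau\in\mathbb R,\ n\in\mathbb Z)$$ be its Fourier transform (in the sense of distributions), and for $s,b,\gamma\in\mathbb R$ put $$\|u\|_{X^{s,b}_{per}}=\Big(\sum_{n\in\mathbb Z}\int_{\mathbb R}\langle\tau+n^2\rangle^{2b}\langle n\rangle^{2s}|\widehat u(\tau,n)|^2\,d\tau\Big)^{1/2},\qquad \|u\|_{Y^{s,b}_{\gamma,per}}=\Big(\sum_{n\in\mathbb Z}\int_{\mathbb R}\langle\tau+\gamma|n|n\rangle^{2b}\langle n\rangle^{2s}|\widehat u(\tau,n)|^2\,d\tau\Big)^{1/2}.$$ **Proposition 3.** There is an absolute constant $\varepsilon_0>0$ such that for every $L>0$ and every $\gamma\in\mathbb R$ with $\gamma\neq0$ and $|\gamma|\neq1$ there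 is a constant $C>0$, depending only on $\gamma$ and the period $L$, such that the following hold for all $s\ge\frac12$ and all $0<\varepsilon\le\varepsilon_0$: 1. if $u,v\in L^2(\mathbb R\times\mathbb T;\mathbb C)$ satisfy $\|u\|_{Y^{s-1/2,1/2}_{\gamma,per}}<\infty$ and $\|v\|_{X^{s,1/2}_{per}}<\infty$, then $$\|uv\|_{X^{s,-1/2+\varepsilon}_{per}}\le C\,\|u\|_{Y^{s-1/2,1/2}_{\gamma,per}}\,\|v\|_{X^{s,1/2}_{per}};$$ 2. if $u,v\in L^2(\mathbb R\times\mathbb T;\mathbb C)$ satisfy $\|u\|_{X^{s,1/2}_{per}}<\infty$ and $\|v\|_{X^{s,1/2}_{per}}<\infty$, then $$\|\partial_x(u\bar v)\|_{Y^{s-1/2,-1/2+\varepsilon}_{\gamma,per}}\le C\,\|u\|_{X^{s,1/2}_{per}}\,\|v\|_{X^{s,1/2}_{per}},$$ where $\partial_x$ is the distributional derivative. -/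

import Mathlib

open MeasureTheory
open scoped ENNReal FourierTransform SchwartzMap

noncomputable section

namespace Bourgain

section TestFunctions

open scoped ContDiff

/-- The lift to `ℝ × ℝ` of a function on `ℝ × 𝕋`, where `𝕋 = ℝ / Lℤ`. -/
def lift {L : ℝ} (φ : ℝ × AddCircle L → ℂ) : ℝ × ℝ → ℂ :=
  fun p => φ (p.1, (p.2 : AddCircle L))

/-- Test functions on `ℝ × 𝕋`: smooth functions of `(t, x)`, of period `L` in `x`, all of whose
derivatives decay rapidly in `t`. -/
structure TestFunction (L : ℝ) where
  toFun : ℝ × AddCircle L → ℂ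
  smooth : ContDiff ℝ ∞ (lift toFun)
  decay : ∀ k m : ℕ, ∃ C : ℝ, ∀ p : ℝ × ℝ,
    |p.1| ^ k * ‖iteratedFDeriv ℝ m (lift toFun) p‖ ≤ C

/-- The derivative in `x` of a function on `ℝ × 𝕋`. -/
def spaceDeriv {L : ℝ} (φ : ℝ × AddCircle L → ℂ) : ℝ × AddCircle L → ℂ :=
  fun p => deriv (fun y : ℝ => φ (p.1, p.2 + (y : AddCircle L))) 0

theorem lift_spaceDeriv {L : ℝ} (φ : ℝ × AddCircle L → ℂ) (h : ContDiff ℝ ∞ (lift φ)) :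
    lift (spaceDeriv φ) = fun p => fderiv ℝ (lift φ) p (0, 1) := by
  funext p
  have h1 : HasFDerivAt (lift φ) (fderiv ℝ (lift φ) p) (p.1, p.2 + 0) := by
    simpa using (h.differentiable (by simp) p).hasFDerivAt
  have h2 : HasDerivAt (fun y : ℝ => (p.1, p.2 + y)) ((0 : ℝ), (1 : ℝ)) 0 :=
    (hasDerivAt_const (0 : ℝ) p.1).prodMk ((hasDerivAt_id (0 : ℝ)).const_add p.2)
  have h3 := h1.comp_hasDerivAt (0 : ℝ) h2
  have h4 := h3.deriv
  simpa [lift, spaceDeriv, Function.comp_def] using h4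

/-- The derivative in `x` of a test function, as a test function. -/
def TestFunction.dx {L : ℝ} (φ : TestFunction L) : TestFunction L where
  toFun := spaceDeriv φ.toFun
  smooth := by
    rw [lift_spaceDeriv _ φ.smooth]
    exact (φ.smooth.fderiv_right (m := ∞) (by simp)).clm_apply contDiff_const
  decay := by
    intro k m
    obtain ⟨C, hC⟩ := φ.decay k (m + 1)
    let A : (ℝ × ℝ →L[ℝ] ℂ) →L[ℝ] ℂ := ContinuousLinearMap.apply ℝ ℂ ((0 : ℝ), (1 : ℝ))
    have hs : ContDiff ℝ ∞ (fderiv ℝ (lift φ.toFun)) :=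
      φ.smooth.fderiv_right (m := ∞) (by simp)
    refine ⟨‖A‖ * C, fun p => ?_⟩
    rw [lift_spaceDeriv _ φ.smooth]
    have h1 : ‖iteratedFDeriv ℝ m (A ∘ fderiv ℝ (lift φ.toFun)) p‖
        ≤ ‖A‖ * ‖iteratedFDeriv ℝ m (fderiv ℝ (lift φ.toFun)) p‖ :=
      A.norm_iteratedFDeriv_comp_left (hs.contDiffAt) (n := m) (by exact_mod_cast le_top)
    rw [norm_iteratedFDeriv_fderiv] at h1
    calc |p.1| ^ k * ‖iteratedFDeriv ℝ m (A ∘ fderiv ℝ (lift φ.toFun)) p‖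
        ≤ |p.1| ^ k * (‖A‖ * ‖iteratedFDeriv ℝ (m + 1) (lift φ.toFun) p‖) := by gcongr
      _ = ‖A‖ * (|p.1| ^ k * ‖iteratedFDeriv ℝ (m + 1) (lift φ.toFun) p‖) := by ring
      _ ≤ ‖A‖ * C := by gcongr; exact hC p

theorem norm_iteratedFDeriv_comp_clm_le {f : ℝ → ℂ} (hf : ContDiff ℝ ∞ f)
    (A : ℝ × ℝ →L[ℝ] ℝ) (hA : ‖A‖ ≤ 1) (i : ℕ) (p : ℝ × ℝ) :
    ‖iteratedFDeriv ℝ i (fun q => f (A q)) p‖ ≤ ‖iteratedFDeriv ℝ i f (A p)‖ := by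
  have h := A.iteratedFDeriv_comp_right hf p (i := i) (by exact_mod_cast le_top)
  change ‖iteratedFDeriv ℝ i (f ∘ A) p‖ ≤ _
  rw [h]
  refine (ContinuousMultilinearMap.norm_compContinuousLinearMap_le _ _).trans ?_
  rw [Finset.prod_const]
  exact mul_le_of_le_one_right (norm_nonneg _) (pow_le_one₀ (norm_nonneg _) hA)

theorem iteratedDeriv_cexp_mul (c : ℂ) (m : ℕ) :
    iteratedDeriv m (fun x : ℝ => Complex.exp (c * x))
      = fun x : ℝ => c ^ m * Complex.exp (c * x) := by
  induction m with
  | zero => simp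
  | succ m ih =>
    rw [iteratedDeriv_succ, ih]
    funext x
    have h0 : HasDerivAt (fun x : ℝ => c * (x : ℂ)) (c * 1) x :=
      (Complex.ofRealCLM.hasDerivAt (x := x)).const_mul c
    have h1 := (h0.cexp.const_mul (c ^ m)).deriv
    rw [h1]
    ring

/-- The test function `ψ(t) exp(2πi n x / L)`, for a Schwartz function `ψ` on `ℝ`. -/
def TestFunction.tensor (L : ℝ) (ψ : 𝓢(ℝ, ℂ)) (n : ℤ) : TestFunction L where
  toFun := fun p => ψ p.1 * fourier n p.2
  smooth := by
    have h : ContDiff ℝ ∞ (fun p : ℝ × ℝ =>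
        ψ p.1 * Complex.exp (2 * Real.pi * Complex.I * n * p.2 / L)) := by
      have h1 : ContDiff ℝ ∞ (fun p : ℝ × ℝ => ψ p.1) := ψ.smooth'.comp contDiff_fst
      have h2 : ContDiff ℝ ∞ (fun p : ℝ × ℝ => (p.2 : ℂ)) :=
        Complex.ofRealCLM.contDiff.comp contDiff_snd
      exact h1.mul ((contDiff_const.mul h2).div_const _).cexp
    have hlift : lift (fun p : ℝ × AddCircle L => ψ p.1 * fourier n p.2) = fun p : ℝ × ℝ =>
        ψ p.1 * Complex.exp (2 * Real.pi * Complex.I * n * p.2 / L) := by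
      funext p
      simp only [lift, fourier_coe_apply]
    rw [hlift]
    exact h
  decay := by
    intro k m
    set c : ℂ := 2 * Real.pi * Complex.I * n / L with hc
    let e : ℝ → ℂ := fun x => Complex.exp (c * x)
    have he : ContDiff ℝ ∞ e :=
      (contDiff_const.mul Complex.ofRealCLM.contDiff).cexp
    have hcre : c.re = 0 := by
      have : c = ((2 * Real.pi * n / L : ℝ) : ℂ) * Complex.I := by
        rw [hc]; push_cast; ring
      rw [this]; simp
    have heb : ∀ (i : ℕ) (x : ℝ), ‖iteratedFDeriv ℝ i e x‖ = ‖c‖ ^ i := by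
      intro i x
      rw [norm_iteratedFDeriv_eq_norm_iteratedDeriv, iteratedDeriv_cexp_mul, norm_mul, norm_pow,
        Complex.norm_exp]
      simp [hcre]
    choose D hD using ψ.decay'
    have hlift : lift (fun p : ℝ × AddCircle L => ψ p.1 * fourier n p.2)
        = fun p : ℝ × ℝ => ψ p.1 * e p.2 := by
      funext p
      simp only [lift, fourier_coe_apply, e]
      congr 2
      rw [hc]; ring
    refine ⟨∑ i ∈ Finset.range (m + 1), (m.choose i : ℝ) * D k i * ‖c‖ ^ (m - i), fun p => ?_⟩
    rw [hlift]
    have h1 : ContDiff ℝ ∞ (fun p : ℝ × ℝ => ψ p.1) := ψ.smooth'.comp contDiff_fst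
    have h2 : ContDiff ℝ ∞ (fun p : ℝ × ℝ => e p.2) := he.comp contDiff_snd
    have hb := norm_iteratedFDeriv_mul_le h1 h2 p (n := m) (by exact_mod_cast le_top)
    refine (mul_le_mul_of_nonneg_left hb (by positivity)).trans ?_
    rw [Finset.mul_sum]
    refine Finset.sum_le_sum fun i _ => ?_
    have b1 : ‖iteratedFDeriv ℝ i (fun p : ℝ × ℝ => ψ p.1) p‖ ≤ ‖iteratedFDeriv ℝ i ψ p.1‖ :=
      norm_iteratedFDeriv_comp_clm_le ψ.smooth' (ContinuousLinearMap.fst ℝ ℝ ℝ)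
        (ContinuousLinearMap.norm_fst_le ..) i p
    have b2 : ‖iteratedFDeriv ℝ (m - i) (fun p : ℝ × ℝ => e p.2) p‖ ≤ ‖c‖ ^ (m - i) :=
      (norm_iteratedFDeriv_comp_clm_le he (ContinuousLinearMap.snd ℝ ℝ ℝ)
        (ContinuousLinearMap.norm_snd_le ..) (m - i) p).trans_eq (heb _ _)
    have b3 : |p.1| ^ k * ‖iteratedFDeriv ℝ i ψ p.1‖ ≤ D k i := hD k i p.1
    calc |p.1| ^ k * ((m.choose i : ℝ) * ‖iteratedFDeriv ℝ i (fun p : ℝ × ℝ => ψ p.1) p‖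
          * ‖iteratedFDeriv ℝ (m - i) (fun p : ℝ × ℝ => e p.2) p‖)
        ≤ |p.1| ^ k * ((m.choose i : ℝ) * ‖iteratedFDeriv ℝ i ψ p.1‖ * ‖c‖ ^ (m - i)) := by
          gcongr
      _ = (m.choose i : ℝ) * (|p.1| ^ k * ‖iteratedFDeriv ℝ i ψ p.1‖) * ‖c‖ ^ (m - i) := by ring
      _ ≤ (m.choose i : ℝ) * D k i * ‖c‖ ^ (m - i) := by gcongr

end TestFunctions

/-- Functionals on test functions. Only functionals given by integrable or square-integrable
functions, and `x`-derivatives of such, are used below; these are tempered distributions. -/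
abbrev Functional (L : ℝ) := TestFunction L → ℂ

/-- The distribution `φ ↦ ∫_{ℝ × 𝕋} w φ dt dx` given by a function `w`. -/
def ofFun {L : ℝ} [Fact (0 < L)] (w : ℝ × AddCircle L → ℂ) : Functional L :=
  fun φ => ∫ p, w p * φ.toFun p

/-- The distributional derivative `∂ₓ T`. -/
def Functional.dx {L : ℝ} (T : Functional L) : Functional L :=
  fun φ => - T φ.dx

/-- `F n τ` is the space-time Fourier transform of `T`, with the normalization
`T^(τ, n) = (2π)^(-1/2) L⁻¹ ∫_{ℝ × 𝕋} T(t, x) exp(-i (2π n x / L + t τ)) dt dx`,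
understood by duality: `F` is tested in `τ = 2πξ` against a Schwartz function `χ(ξ)`, and
`𝓕 χ (t) = ∫ χ(ξ) exp(-2πi t ξ) dξ = ∫ χ(ξ) exp(-i t τ) dξ`. -/
def HasFourierTransform {L : ℝ} (T : Functional L) (F : ℤ → ℝ → ℂ) : Prop :=
  ∀ (n : ℤ) (χ : 𝓢(ℝ, ℂ)),
    Integrable (fun ξ : ℝ => F n (2 * Real.pi * ξ) * χ ξ) ∧
    ∫ ξ : ℝ, F n (2 * Real.pi * ξ) * χ ξ
      = ((Real.sqrt (2 * Real.pi) * L)⁻¹ : ℝ) * T (TestFunction.tensor L (𝓕 χ) (-n))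

/-- `⟨x⟩ = 1 + |x|`. -/
def japanese (x : ℝ) : ℝ := 1 + |x|

/-- `(∑ₙ ∫ ⟨τ + disp(n)⟩^(2b) ⟨n⟩^(2s) |F(τ, n)|² dτ)^(1/2)`, possibly infinite. -/
def weightedNorm (disp : ℤ → ℝ) (s b : ℝ) (F : ℤ → ℝ → ℂ) : ℝ≥0∞ :=
  (∑' n : ℤ, ∫⁻ τ : ℝ, ENNReal.ofReal
    (japanese (τ + disp n) ^ (2 * b) * japanese (n : ℝ) ^ (2 * s) * ‖F n τ‖ ^ 2)) ^ (1 / 2 : ℝ)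

/-- The norm of a distribution with relation `τ = -disp(n)`. The Fourier transform `F` is unique up to
null sets, so the infimum is the weighted norm of the Fourier transform of `T` if this is a
function, and it is `∞` otherwise. -/
def bourgainNorm {L : ℝ} (disp : ℤ → ℝ) (s b : ℝ) (T : Functional L) : ℝ≥0∞ :=
  ⨅ (F : ℤ → ℝ → ℂ) (_ : HasFourierTransform T F), weightedNorm disp s b F

/-- The norm of the periodic Schrödinger space `X^{s,b}`. -/
def normX {L : ℝ} (s b : ℝ) (T : Functional L) : ℝ≥0∞ :=
  bourgainNorm (fun n => (n : ℝ) ^ 2) s b T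

/-- The norm of the periodic Benjamin-Ono space `Y^{s,b}_γ`. -/
def normY {L : ℝ} (γ s b : ℝ) (T : Functional L) : ℝ≥0∞ :=
  bourgainNorm (fun n => γ * |(n : ℝ)| * n) s b T

end Bourgain

end

/-! The Fourier transform turns products into convolutions, so by duality both estimates bound one
trilinear form ∫∫ f(x) g(y) h(x + y) on frequency space ℤ × ℝ. Here f carries the Benjamin-Ono
frequency n₁, while g and h carry the Schrödinger frequencies n₂ and n = n₁ + n₂. The modulations σ₁
= τ₁ + γ|n₁|n₁, σ₂ = τ₂ + n₂² and σ = τ + n² satisfy σ − σ₁ − σ₂ = n² − n₂² − γ|n₁|n₁ = n₁(2n₂ + (1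
∓ γ)n₁).

Since |γ| ≠ 1, this is at least a multiple of n₁² as soon as n₂ or n is small compared with n₁
(`gap_mul_sq_le_abs_resonance`). Hence either some modulation is large or both Schrödinger
frequencies control n₁. With M = ⟨σ⟩^(1/4) + ⟨σ₁⟩^(1/4) + ⟨σ₂⟩^(1/4), this gives ⟨n⟩^(1/2) ≲
⟨n₂⟩^(1/2) M and ⟨n₁⟩ ≲ ⟨n⟩^(1/2) ⟨n₂⟩^(1/2) M, which pay for the missing half derivative in the
first estimate and for ∂ₓ in the second. Only a quarter power of one modulation is spent, so two of
the three functions always keep a weight ⟨modulation⟩^(-7/16) (`weights_le`).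

A trilinear form with two such weights is bounded on L² by Cauchy–Schwarz, provided the convolution
(or correlation) of the squared weights is bounded. Integration in τ leaves Σₖ ⟨Q(k)⟩^(-5/8) with Q
piecewise quadratic, which is bounded uniformly because ⟨Q(k)⟩ grows at least like the square of the
distance to one of two points. The leading coefficients are ±1 ± γ and 2, all nonzero
(`exists_kernel_bound`). When the weights sit on the two Schrödinger factors, a correlation appears,
whose phase k² − (k + m)² is only linear in k. The identity ‖g h̄‖₂ = ‖g h‖₂, in the form
`lintegral_corr_sq_eq_conv_sq`, replaces it by a convolution. -/

noncomputable section

namespace Bourgain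

/-! ### Fourier transforms on the line, by duality -/

/-- `A` is the Fourier transform of `a : ℝ → ℂ` in the sense of tempered distributions. -/
def IsDualFourier (a A : ℝ → ℂ) : Prop :=
  ∀ χ : 𝓢(ℝ, ℂ), Integrable (fun ξ => A ξ * χ ξ) ∧ ∫ ξ, A ξ * χ ξ = ∫ t, a t * 𝓕 χ t

theorem locallyIntegrable_of_forall_schwartz {A : ℝ → ℂ}
    (h : ∀ χ : 𝓢(ℝ, ℂ), Integrable (fun ξ => A ξ * χ ξ)) : LocallyIntegrable A := by
  intro x
  let b : ContDiffBump x := ⟨1, 2, by norm_num, by norm_num⟩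
  have hb : ContDiff ℝ ((⊤ : ℕ∞) : WithTop ℕ∞) (fun y => ((b y : ℝ) : ℂ)) :=
    Complex.ofRealCLM.contDiff.comp b.contDiff
  have hs : HasCompactSupport (fun y => ((b y : ℝ) : ℂ)) :=
    b.hasCompactSupport.comp_left (g := fun r : ℝ => (r : ℂ)) (by simp)
  refine ⟨Metric.closedBall x 1, Metric.closedBall_mem_nhds x one_pos, ?_⟩
  have h1 := (h (hs.toSchwartzMap hb)).integrableOn (s := Metric.closedBall x 1)
  refine h1.congr_fun (fun y hy => ?_) measurableSet_closedBall
  have : b y = 1 := b.one_of_mem_closedBall hy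
  simp [this]

/-- Both sides are locally integrable and have the same pairing with every smooth compactly
supported function. This makes Plancherel's theorem available for transforms that are only given by
duality. -/
theorem IsDualFourier.ae_eq {a A : ℝ → ℂ} (h : IsDualFourier a A) (ha : MemLp a 2) :
    A =ᵐ[volume] (𝓕 (ha.toLp a) : Lp ℂ 2 (volume : Measure ℝ)) := by
  refine ae_eq_of_integral_contDiff_smul_eq
    (locallyIntegrable_of_forall_schwartz fun χ => (h χ).1)
    ((Lp.memLp (𝓕 (ha.toLp a) : Lp ℂ 2 (volume : Measure ℝ))).locallyIntegrable (by norm_num))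
    fun g hg hs => ?_
  have hb : ContDiff ℝ ((⊤ : ℕ∞) : WithTop ℕ∞) (fun y => ((g y : ℝ) : ℂ)) :=
    Complex.ofRealCLM.contDiff.comp hg
  have hs' : HasCompactSupport (fun y => ((g y : ℝ) : ℂ)) :=
    hs.comp_left (g := fun r : ℝ => (r : ℂ)) (by simp)
  set χ := hs'.toSchwartzMap hb with hχ
  have e1 := Lp.fourier_toTemperedDistribution_eq (E := ℝ) (ha.toLp a)
  have e2 := congrArg (fun T : 𝓢'(ℝ, ℂ) => T χ) e1
  simp only [TemperedDistribution.fourier_apply, Lp.toTemperedDistribution_apply] at e2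
  have e3 : ∫ x, g x • A x = ∫ t, a t * 𝓕 χ t := by
    rw [← (h χ).2]
    refine integral_congr_ae (Filter.Eventually.of_forall fun x => ?_)
    simp [hχ, mul_comm]
  rw [e3]
  have e4 : ∫ t, a t * 𝓕 χ t = ∫ t, 𝓕 χ t • (ha.toLp a) t := by
    refine integral_congr_ae ?_
    filter_upwards [ha.coeFn_toLp] with t ht
    rw [ht, smul_eq_mul, mul_comm]
  rw [e4, e2]
  refine integral_congr_ae (Filter.Eventually.of_forall fun x => ?_)
  simp [hχ]

/-- The Schwartz function `x ↦ conj (χ (-x))`. -/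
def conjReflect (χ : 𝓢(ℝ, ℂ)) : 𝓢(ℝ, ℂ) :=
  SchwartzMap.postcompCLM (𝕜 := ℝ) (Complex.conjCLE : ℂ →L[ℝ] ℂ)
    (SchwartzMap.compCLMOfContinuousLinearEquiv ℝ (ContinuousLinearEquiv.neg ℝ) χ)

theorem conjReflect_apply (χ : 𝓢(ℝ, ℂ)) (x : ℝ) :
    conjReflect χ x = (starRingEnd ℂ) (χ (-x)) := by
  simp [conjReflect]

theorem fourier_conjReflect (χ : 𝓢(ℝ, ℂ)) (t : ℝ) :
    𝓕 (conjReflect χ) t = (starRingEnd ℂ) (𝓕 χ t) := by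
  rw [SchwartzMap.fourier_coe, SchwartzMap.fourier_coe, Real.fourier_real_eq_integral_exp_smul,
    Real.fourier_real_eq_integral_exp_smul, ← integral_conj, ← integral_neg_eq_self]
  refine integral_congr_ae (Filter.Eventually.of_forall fun x => ?_)
  simp only [conjReflect_apply, smul_eq_mul, map_mul, ← Complex.exp_conj]
  simp [map_ofNat]

theorem fourier_compSubConst (χ : 𝓢(ℝ, ℂ)) (a t : ℝ) :
    𝓕 (SchwartzMap.compSubConstCLM ℂ a χ) t
      = Complex.exp (-2 * Real.pi * a * t * Complex.I) * 𝓕 χ t := by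
  rw [SchwartzMap.fourier_coe, SchwartzMap.fourier_coe, Real.fourier_real_eq_integral_exp_smul,
    Real.fourier_real_eq_integral_exp_smul, ← integral_const_mul]
  rw [← integral_add_right_eq_self _ a]
  refine integral_congr_ae (Filter.Eventually.of_forall fun x => ?_)
  simp only [SchwartzMap.compSubConstCLM_apply, smul_eq_mul, add_sub_cancel_right]
  rw [← mul_assoc, ← Complex.exp_add]
  congr 2
  push_cast
  ring

theorem IsDualFourier.conj {a A : ℝ → ℂ} (h : IsDualFourier a A) :
    IsDualFourier (fun t => (starRingEnd ℂ) (a t)) (fun ξ => (starRingEnd ℂ) (A (-ξ))) := by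
  intro χ
  obtain ⟨h1, h2⟩ := h (conjReflect χ)
  have e : (fun ξ => (starRingEnd ℂ) (A (-ξ)) * χ ξ)
      = fun ξ => (starRingEnd ℂ) (A (-ξ) * conjReflect χ (-ξ)) := by
    funext ξ
    simp [conjReflect_apply]
  refine ⟨?_, ?_⟩
  · rw [e]
    have h3 : Integrable (fun ξ => A (-ξ) * conjReflect χ (-ξ)) := h1.comp_neg
    exact (LinearIsometryEquiv.integrable_comp_iff (Complex.conjLIE)).2 h3
  · rw [e, integral_conj, integral_neg_eq_self (fun ξ => A ξ * conjReflect χ ξ), h2,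
      ← integral_conj]
    refine integral_congr_ae (Filter.Eventually.of_forall fun x => ?_)
    simp [fourier_conjReflect]

/-- Parseval's identity, in bilinear form. -/
theorem IsDualFourier.integral_mul_eq {a A b B : ℝ → ℂ} (hA : IsDualFourier a A)
    (hB : IsDualFourier b B) (ha : MemLp a 2) (hb : MemLp b 2) :
    ∫ t, a t * b t = ∫ ξ, A ξ * B (-ξ) := by
  have hb' : MemLp (fun t => (starRingEnd ℂ) (b t)) 2 := hb.star
  -- Conjugating `b` turns the sesquilinear identity into a bilinear one; this is the source of the
  -- reflection in `B (-ξ)`.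
  have h := Lp.inner_fourier_eq (E := ℝ) (hb'.toLp _) (ha.toLp a)
  rw [L2.inner_def, L2.inner_def] at h
  calc ∫ t, a t * b t = _ := ?_
    _ = _ := h.symm
    _ = _ := ?_
  · refine integral_congr_ae ?_
    filter_upwards [ha.coeFn_toLp, hb'.coeFn_toLp] with t h1 h2
    rw [h1, h2]
    simp
  · refine integral_congr_ae ?_
    filter_upwards [hA.ae_eq ha, hB.conj.ae_eq hb'] with t h1 h2
    rw [← h1, ← h2]
    simp

/-! ### Fourier series in x and Parseval's identity on ℝ × 𝕋 -/

section

theorem norm_fourier_apply {T : ℝ} (k : ℤ) (x : AddCircle T) : ‖fourier k x‖ = 1 := by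
  rw [fourier_apply, Circle.norm_coe]

variable {L : ℝ} [hL : Fact (0 < L)]

/-- The Fourier coefficient in `x` of a function of `(t, x)`. -/
def spaceCoeff (u : ℝ × AddCircle L → ℂ) (k : ℤ) (t : ℝ) : ℂ :=
  fourierCoeff (fun x => u (t, x)) k

theorem spaceCoeff_eq (u : ℝ × AddCircle L → ℂ) (k : ℤ) (t : ℝ) :
    spaceCoeff u k t = (L⁻¹ : ℂ) * ∫ x : AddCircle L, u (t, x) * fourier (-k) x := by
  rw [spaceCoeff, fourierCoeff, AddCircle.integral_haarAddCircle]
  simp only [smul_eq_mul, Complex.real_smul, Complex.ofReal_inv, mul_comm]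

theorem aestronglyMeasurable_spaceCoeff {u : ℝ × AddCircle L → ℂ} (hu : MemLp u 2) (k : ℤ) :
    AEStronglyMeasurable (spaceCoeff u k) := by
  have h : AEStronglyMeasurable (fun p : ℝ × AddCircle L => u p * fourier (-k) p.2)
      ((volume : Measure ℝ).prod volume) :=
    hu.1.mul ((fourier (-k)).continuous.comp continuous_snd).aestronglyMeasurable
  have h2 := (h.integral_prod_right').const_mul (L⁻¹ : ℂ)
  refine h2.congr (Filter.Eventually.of_forall fun t => ?_)
  simp only [spaceCoeff_eq]

/-- Parseval's identity on the circle, for square-integrable functions. -/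
theorem hasSum_fourierCoeff_mul {f g : AddCircle L → ℂ} (hf : MemLp f 2) (hg : MemLp g 2) :
    HasSum (fun k : ℤ => fourierCoeff f k * fourierCoeff g (-k))
      ((L⁻¹ : ℂ) * ∫ x, f x * g x) := by
  have hf' : MemLp f 2 AddCircle.haarAddCircle := memLp_haarAddCircle_iff.2 hf
  have hg' : MemLp (fun x => (starRingEnd ℂ) (g x)) 2 AddCircle.haarAddCircle :=
    memLp_haarAddCircle_iff.2 hg.star
  have h := (fourierBasis (T := L)).hasSum_inner_mul_inner (hg'.toLp _) (hf'.toLp f)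
  have e1 : inner ℂ (hg'.toLp _) (hf'.toLp f) = (L⁻¹ : ℂ) * ∫ x, f x * g x := by
    rw [L2.inner_def]
    have : ∀ᵐ x ∂(AddCircle.haarAddCircle (T := L)),
        inner ℂ ((hg'.toLp _) x) ((hf'.toLp f) x) = f x * g x := by
      filter_upwards [hf'.coeFn_toLp, hg'.coeFn_toLp] with x h1 h2
      rw [h1, h2]
      simp
    rw [integral_congr_ae this, AddCircle.integral_haarAddCircle]
    simp
  rw [e1] at h
  convert! h using 1
  funext k
  have e2 : inner ℂ (fourierBasis (T := L) k) (hf'.toLp f) = fourierCoeff f k := by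
    rw [← HilbertBasis.repr_apply_apply, fourierBasis_repr]
    exact congrFun (fourierCoeff_congr_ae hf'.coeFn_toLp) k
  have e3 : inner ℂ (hg'.toLp _) (fourierBasis (T := L) k) = fourierCoeff g (-k) := by
    rw [← inner_conj_symm, ← HilbertBasis.repr_apply_apply, fourierBasis_repr,
      fourierCoeff_congr_ae hg'.coeFn_toLp, fourierCoeff, fourierCoeff, ← integral_conj]
    refine integral_congr_ae (Filter.Eventually.of_forall fun x => ?_)
    simp only [smul_eq_mul, map_mul, Complex.conj_conj, ← fourier_neg]
  rw [e2, e3, mul_comm]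

theorem tsum_enorm_sq_fourierCoeff {f : AddCircle L → ℂ} (hf : MemLp f 2) :
    ∑' k : ℤ, ‖fourierCoeff f k‖ₑ ^ 2 = ENNReal.ofReal L⁻¹ * ∫⁻ x, ‖f x‖ₑ ^ 2 := by
  have hf' : MemLp f 2 AddCircle.haarAddCircle := memLp_haarAddCircle_iff.2 hf
  have h := hasSum_sq_fourierCoeff (hf'.toLp f)
  have e : ∀ k, fourierCoeff (hf'.toLp f) k = fourierCoeff f k :=
    fun k => congrFun (fourierCoeff_congr_ae hf'.coeFn_toLp) k
  simp only [e] at h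
  have e2 : ∫ t : AddCircle L, ‖(hf'.toLp f) t‖ ^ 2 ∂AddCircle.haarAddCircle
      = L⁻¹ * ∫ t, ‖f t‖ ^ 2 := by
    rw [← smul_eq_mul, ← AddCircle.integral_haarAddCircle]
    refine integral_congr_ae ?_
    filter_upwards [hf'.coeFn_toLp] with x hx
    rw [hx]
  rw [e2] at h
  have e3 : ∀ z : ℂ, ‖z‖ₑ ^ 2 = ENNReal.ofReal (‖z‖ ^ 2) := fun z => by
    rw [ENNReal.ofReal_pow (norm_nonneg _), ofReal_norm]
  simp only [e3]
  rw [← ENNReal.ofReal_tsum_of_nonneg (fun k => by positivity) h.summable, h.tsum_eq,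
    ENNReal.ofReal_mul (inv_nonneg.2 hL.out.le), ofReal_integral_eq_lintegral_ofReal
      ((memLp_two_iff_integrable_sq_norm hf.1).1 hf)
      (Filter.Eventually.of_forall fun x => by positivity)]

theorem memLp_two_iff_lintegral {α : Type*} [MeasurableSpace α] {μ : Measure α} {f : α → ℂ} :
    MemLp f 2 μ ↔ AEStronglyMeasurable f μ ∧ ∫⁻ x, ‖f x‖ₑ ^ 2 ∂μ < ∞ := by
  rw [MemLp, eLpNorm_lt_top_iff_lintegral_rpow_enorm_lt_top (by norm_num) (by norm_num)]
  simp

theorem ae_memLp_slice {u : ℝ × AddCircle L → ℂ} (hu : MemLp u 2) :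
    ∀ᵐ t : ℝ, MemLp (fun x => u (t, x)) 2 := by
  have hu1 : AEStronglyMeasurable u ((volume : Measure ℝ).prod volume) := hu.1
  have h1 := (memLp_two_iff_lintegral.1 hu).2
  rw [Measure.volume_eq_prod, lintegral_prod _ (by fun_prop)] at h1
  have h2 := ae_lt_top' (by exact (hu1.enorm.pow_const 2).lintegral_prod_right') h1.ne
  filter_upwards [hu1.prodMk_left, h2] with t ht1 ht2
  exact memLp_two_iff_lintegral.2 ⟨ht1, ht2⟩

theorem lintegral_tsum_spaceCoeff_lt_top {u : ℝ × AddCircle L → ℂ} (hu : MemLp u 2) :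
    ∫⁻ t, ∑' k : ℤ, ‖spaceCoeff u k t‖ₑ ^ 2 < ∞ := by
  have hu1 : AEStronglyMeasurable u ((volume : Measure ℝ).prod volume) := hu.1
  have h1 := (memLp_two_iff_lintegral.1 hu).2
  rw [Measure.volume_eq_prod, lintegral_prod _ (by fun_prop)] at h1
  calc ∫⁻ t, ∑' k : ℤ, ‖spaceCoeff u k t‖ₑ ^ 2
      = ∫⁻ t, ENNReal.ofReal L⁻¹ * ∫⁻ x, ‖u (t, x)‖ₑ ^ 2 := by
        refine lintegral_congr_ae ?_
        filter_upwards [ae_memLp_slice hu] with t ht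
        exact tsum_enorm_sq_fourierCoeff ht
    _ = ENNReal.ofReal L⁻¹ * ∫⁻ t, ∫⁻ x, ‖u (t, x)‖ₑ ^ 2 :=
        lintegral_const_mul' _ _ ENNReal.ofReal_ne_top
    _ < ∞ := ENNReal.mul_lt_top ENNReal.ofReal_lt_top h1

theorem memLp_spaceCoeff {u : ℝ × AddCircle L → ℂ} (hu : MemLp u 2) (k : ℤ) :
    MemLp (spaceCoeff u k) 2 := by
  refine memLp_two_iff_lintegral.2 ⟨aestronglyMeasurable_spaceCoeff hu k,
    (lintegral_mono fun t => ?_).trans_lt (lintegral_tsum_spaceCoeff_lt_top hu)⟩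
  exact ENNReal.le_tsum (f := fun k : ℤ => ‖spaceCoeff u k t‖ₑ ^ 2) k

/-- Parseval on almost every circle {t} × 𝕋, followed by an exchange of sum and integral. The
exchange is justified by |ab| ≤ |a|² + |b|² and the square summability of the coefficients. -/
theorem integral_mul_eq_tsum_spaceCoeff {u w : ℝ × AddCircle L → ℂ}
    (hu : MemLp u 2) (hw : MemLp w 2) :
    ∫ p, u p * w p = L * ∑' k : ℤ, ∫ t, spaceCoeff u k t * spaceCoeff w (-k) t := by
  have hint : Integrable (fun p => u p * w p) ((volume : Measure ℝ).prod volume) :=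
    hu.integrable_mul hw
  have hL0 : (L : ℂ) ≠ 0 := by exact_mod_cast hL.out.ne'
  rw [← integral_tsum, Measure.volume_eq_prod, integral_prod _ hint, ← integral_const_mul]
  · refine integral_congr_ae ?_
    filter_upwards [ae_memLp_slice hu, ae_memLp_slice hw] with t h1 h2
    simp only [spaceCoeff]
    rw [(hasSum_fourierCoeff_mul h1 h2).tsum_eq, ← mul_assoc, mul_inv_cancel₀ hL0, one_mul]
  · exact fun k => (aestronglyMeasurable_spaceCoeff hu k).mul
      (aestronglyMeasurable_spaceCoeff hw (-k))
  · rw [← lintegral_tsum fun k => AEStronglyMeasurable.enorm (by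
      exact (aestronglyMeasurable_spaceCoeff hu k).mul (aestronglyMeasurable_spaceCoeff hw (-k)))]
    have hmeas : AEMeasurable fun t => ∑' k : ℤ, ‖spaceCoeff u k t‖ₑ ^ 2 :=
      AEMeasurable.tsum fun k => (aestronglyMeasurable_spaceCoeff hu k).enorm.pow_const 2
    have hlt := ENNReal.add_lt_top.2
      ⟨lintegral_tsum_spaceCoeff_lt_top hu, lintegral_tsum_spaceCoeff_lt_top hw⟩
    rw [← lintegral_add_left' hmeas] at hlt
    refine ((lintegral_mono fun t => ?_).trans_lt hlt).ne
    have e : ∑' k : ℤ, ‖spaceCoeff w k t‖ₑ ^ 2 = ∑' k : ℤ, ‖spaceCoeff w (-k) t‖ₑ ^ 2 :=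
      ((Equiv.neg ℤ).tsum_eq fun k => ‖spaceCoeff w k t‖ₑ ^ 2).symm
    rw [e, ← ENNReal.tsum_add]
    refine ENNReal.tsum_le_tsum fun k => ?_
    rw [enorm_mul]
    rcases le_total ‖spaceCoeff u k t‖ₑ ‖spaceCoeff w (-k) t‖ₑ with h | h
    · exact (mul_le_mul' h le_rfl).trans ((sq _).symm.le.trans le_add_self)
    · exact (mul_le_mul' le_rfl h).trans ((sq _).symm.le.trans le_self_add)

theorem memLp_schwartz_mul_fourier (ψ : 𝓢(ℝ, ℂ)) (k : ℤ) :
    MemLp (fun p : ℝ × AddCircle L => ψ p.1 * fourier k p.2) 2 := by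
  refine memLp_two_iff_lintegral.2 ⟨(ψ.continuous.comp continuous_fst).mul
    ((fourier k).continuous.comp continuous_snd) |>.aestronglyMeasurable, ?_⟩
  have e : ∀ p : ℝ × AddCircle L, ‖ψ p.1 * fourier k p.2‖ₑ ^ 2 = ‖ψ p.1‖ₑ ^ 2 * 1 := by
    intro p
    rw [enorm_mul, ← ofReal_norm (fourier k p.2), norm_fourier_apply]
    simp
  simp only [e]
  rw [Measure.volume_eq_prod, lintegral_prod_mul (f := fun t => ‖ψ t‖ₑ ^ 2) (g := fun _ => 1)
    (by exact (ψ.continuous.measurable.enorm.pow_const 2).aemeasurable) aemeasurable_const]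
  refine ENNReal.mul_lt_top (memLp_two_iff_lintegral.1 (ψ.memLp 2)).2 ?_
  simp

theorem ofFun_tensor {u : ℝ × AddCircle L → ℂ} (hu : MemLp u 2) (ψ : 𝓢(ℝ, ℂ)) (k : ℤ) :
    ofFun u (TestFunction.tensor L ψ (-k)) = L * ∫ t, spaceCoeff u k t * ψ t := by
  have hint : Integrable (fun p => u p * (ψ p.1 * fourier (-k) p.2))
      ((volume : Measure ℝ).prod volume) :=
    hu.integrable_mul (memLp_schwartz_mul_fourier ψ (-k))
  have hL0 : (L : ℂ) ≠ 0 := by exact_mod_cast hL.out.ne'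
  change ∫ p, u p * (ψ p.1 * fourier (-k) p.2) = _
  rw [Measure.volume_eq_prod, integral_prod _ hint, ← integral_const_mul]
  refine integral_congr_ae (Filter.Eventually.of_forall fun t => ?_)
  simp only [spaceCoeff_eq]
  rw [← mul_assoc, ← mul_assoc, mul_inv_cancel₀ hL0, one_mul, ← integral_mul_const]
  refine integral_congr_ae (Filter.Eventually.of_forall fun x => ?_)
  simp only
  ring

/-- The factor √(2π) converts the normalization in τ = 2πξ into that of `𝓕` in ξ. -/
theorem HasFourierTransform.isDualFourier {u : ℝ × AddCircle L → ℂ} (hu : MemLp u 2)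
    {F : ℤ → ℝ → ℂ} (h : HasFourierTransform (ofFun u) F) (k : ℤ) :
    IsDualFourier (spaceCoeff u k)
      (fun ξ => (Real.sqrt (2 * Real.pi) : ℂ) * F k (2 * Real.pi * ξ)) := by
  intro χ
  obtain ⟨h1, h2⟩ := h k χ
  have hL0 : (L : ℂ) ≠ 0 := by exact_mod_cast hL.out.ne'
  have hs : (Real.sqrt (2 * Real.pi) : ℂ) ≠ 0 := by
    exact_mod_cast (Real.sqrt_pos.2 Real.two_pi_pos).ne'
  simp only [mul_assoc]
  refine ⟨by simpa only [mul_assoc] using h1.const_mul _, ?_⟩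
  rw [integral_const_mul]
  simp only [mul_assoc] at h2
  rw [h2, ofFun_tensor hu]
  push_cast
  field_simp

/-- Parseval's identity on `ℝ × 𝕋`, as an inequality between absolute values. -/
theorem enorm_integral_mul_le {u w : ℝ × AddCircle L → ℂ} (hu : MemLp u 2) (hw : MemLp w 2)
    {F G : ℤ → ℝ → ℂ} (hF : HasFourierTransform (ofFun u) F)
    (hG : HasFourierTransform (ofFun w) G) :
    ‖∫ p, u p * w p‖ₑ ≤ ENNReal.ofReal L * ∑' k : ℤ, ∫⁻ τ, ‖F k τ‖ₑ * ‖G (-k) (-τ)‖ₑ := by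
  rw [integral_mul_eq_tsum_spaceCoeff hu hw, enorm_mul]
  have e1 : ‖(L : ℂ)‖ₑ = ENNReal.ofReal L := by
    rw [← ofReal_norm, Complex.norm_real, Real.norm_of_nonneg hL.out.le]
  rw [e1]
  gcongr
  refine (enorm_tsum_le_tsum_enorm).trans (ENNReal.tsum_le_tsum fun k => ?_)
  rw [(hF.isDualFourier hu k).integral_mul_eq (hG.isDualFourier hw (-k)) (memLp_spaceCoeff hu k)
    (memLp_spaceCoeff hw (-k))]
  have e2 : ∫ ξ, (Real.sqrt (2 * Real.pi) : ℂ) * F k (2 * Real.pi * ξ)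
      * ((Real.sqrt (2 * Real.pi) : ℂ) * G (-k) (2 * Real.pi * -ξ))
      = ∫ τ, F k τ * G (-k) (-τ) := by
    have h := Measure.integral_comp_mul_left (fun τ => F k τ * G (-k) (-τ)) (2 * Real.pi)
    have h2 : (Real.sqrt (2 * Real.pi) : ℂ) * (Real.sqrt (2 * Real.pi) : ℂ)
        = ((2 * Real.pi : ℝ) : ℂ) := by
      rw [← Complex.ofReal_mul, Real.mul_self_sqrt Real.two_pi_pos.le]
    have h3 : ∀ ξ : ℝ, (Real.sqrt (2 * Real.pi) : ℂ) * F k (2 * Real.pi * ξ)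
      * ((Real.sqrt (2 * Real.pi) : ℂ) * G (-k) (2 * Real.pi * -ξ))
      = ((2 * Real.pi : ℝ) : ℂ) * (F k (2 * Real.pi * ξ) * G (-k) (-(2 * Real.pi * ξ))) := by
      intro ξ
      rw [← h2, mul_neg]
      ring
    simp only [h3]
    rw [integral_const_mul, h, abs_of_pos (inv_pos.2 Real.two_pi_pos), Complex.real_smul,
      ← mul_assoc, ← Complex.ofReal_mul, mul_inv_cancel₀ Real.two_pi_pos.ne']
    simp
  rw [e2]
  refine (enorm_integral_le_lintegral_enorm _).trans_eq ?_
  simp only [enorm_mul]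

end

/-! ### Fourier transforms of products, conjugates and derivatives -/

section

theorem spaceDeriv_tensor {L : ℝ} (ψ : 𝓢(ℝ, ℂ)) (n : ℤ) (p : ℝ × AddCircle L) :
    (TestFunction.tensor L ψ n).dx.toFun p
      = (2 * Real.pi * Complex.I * n / L) * (TestFunction.tensor L ψ n).toFun p := by
  change deriv (fun y : ℝ => ψ p.1 * fourier n (p.2 + (y : AddCircle L))) 0
    = (2 * Real.pi * Complex.I * n / L) * (ψ p.1 * fourier n p.2)
  have e : (fun y : ℝ => ψ p.1 * fourier n (p.2 + (y : AddCircle L)))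
      = fun y : ℝ => (ψ p.1 * fourier n p.2) * fourier n (y : AddCircle L) := by
    funext y
    simp only [fourier_apply, smul_add, AddCircle.toCircle_add, Circle.coe_mul]
    ring
  rw [e, ((hasDerivAt_fourier L n 0).const_mul _).deriv]
  simp
  ring

variable {L : ℝ} [hL : Fact (0 < L)]

theorem norm_exp_neg_mul_I (τ t : ℝ) : ‖Complex.exp (-(τ * t) * Complex.I)‖ = 1 := by
  have := Complex.norm_exp_ofReal_mul_I (-(τ * t))
  simpa using this

theorem memLp_modulation {v : ℝ × AddCircle L → ℂ} (hv : MemLp v 2) (n : ℤ) (τ : ℝ) :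
    MemLp (fun p => v p * (Complex.exp (-(τ * p.1) * Complex.I) * fourier (-n) p.2)) 2 := by
  refine hv.of_le (hv.1.mul ?_) (Filter.Eventually.of_forall fun p => ?_)
  · have h : Continuous fun p : ℝ × AddCircle L =>
        Complex.exp (-((τ : ℂ) * (p.1 : ℂ)) * Complex.I) * fourier (-n) p.2 := by
      fun_prop
    exact h.aestronglyMeasurable
  · rw [norm_mul, norm_mul, norm_exp_neg_mul_I, norm_fourier_apply]
    simp

/-- A modulation translates the transform. Applied to one factor, it makes each Fourier coefficient
of a product a pairing of two L² functions, to which Parseval applies. -/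
theorem HasFourierTransform.modulation {v : ℝ × AddCircle L → ℂ} {F : ℤ → ℝ → ℂ}
    (h : HasFourierTransform (ofFun v) F) (n : ℤ) (τ : ℝ) :
    HasFourierTransform
      (ofFun fun p => v p * (Complex.exp (-(τ * p.1) * Complex.I) * fourier (-n) p.2))
      (fun k σ => F (n + k) (τ + σ)) := by
  intro k χ
  set a : ℝ := τ / (2 * Real.pi) with ha
  obtain ⟨h1, h2⟩ := h (n + k) (SchwartzMap.compSubConstCLM ℂ a χ)
  have hpi : (2 * Real.pi) ≠ 0 := Real.two_pi_pos.ne'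
  have e : (fun ξ => F (n + k) (τ + 2 * Real.pi * ξ) * χ ξ) = fun ξ =>
      (fun ξ => F (n + k) (2 * Real.pi * ξ) * SchwartzMap.compSubConstCLM ℂ a χ ξ) (ξ + a) := by
    funext ξ
    have : 2 * Real.pi * (ξ + a) = τ + 2 * Real.pi * ξ := by
      rw [ha]; field_simp; ring
    simp only [SchwartzMap.compSubConstCLM_apply, add_sub_cancel_right, this]
  refine ⟨?_, ?_⟩
  · rw [e]
    exact h1.comp_add_right a
  · rw [e, integral_add_right_eq_self
      (fun ξ => F (n + k) (2 * Real.pi * ξ) * SchwartzMap.compSubConstCLM ℂ a χ ξ), h2]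
    congr 1
    refine integral_congr_ae (Filter.Eventually.of_forall fun p => ?_)
    simp only [TestFunction.tensor, fourier_compSubConst]
    rw [neg_add, fourier_add]
    have : (-2 * Real.pi * a * p.1 * Complex.I : ℂ) = -(τ * p.1) * Complex.I := by
      rw [ha]
      push_cast
      field_simp
    rw [this]
    ring

/-- The Fourier transform of an integrable function on `ℝ × 𝕋`. -/
def fourierIntegral (w : ℝ × AddCircle L → ℂ) (n : ℤ) (τ : ℝ) : ℂ :=
  ((Real.sqrt (2 * Real.pi) * L)⁻¹ : ℝ) *
    ∫ p, w p * (Complex.exp (-(τ * p.1) * Complex.I) * fourier (-n) p.2)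

theorem hasFourierTransform_fourierIntegral {w : ℝ × AddCircle L → ℂ} (hw : Integrable w) :
    HasFourierTransform (ofFun w) (fourierIntegral w) := by
  intro n χ
  have hint : Integrable (fun q : ℝ × (ℝ × AddCircle L) => χ q.1 * w q.2 *
      (Complex.exp (-(((2 * Real.pi * q.1 : ℝ) : ℂ) * q.2.1) * Complex.I) * fourier (-n) q.2.2))
      ((volume : Measure ℝ).prod volume) := by
    refine (χ.integrable.mul_prod hw).mul_bdd (c := 1) ?_ (Filter.Eventually.of_forall fun q => ?_)
    · have h : Continuous fun q : ℝ × (ℝ × AddCircle L) =>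
          (Complex.exp (-(((2 * Real.pi * q.1 : ℝ) : ℂ) * (q.2.1 : ℂ)) * Complex.I)
            * fourier (-n) q.2.2) := by
        fun_prop
      exact h.aestronglyMeasurable
    · rw [norm_mul, norm_exp_neg_mul_I, norm_fourier_apply, one_mul]
  have e : (fun ξ => fourierIntegral w n (2 * Real.pi * ξ) * χ ξ) = fun ξ =>
      (((Real.sqrt (2 * Real.pi) * L)⁻¹ : ℝ) : ℂ) * ∫ p : ℝ × AddCircle L, χ ξ * w p *
      (Complex.exp (-(((2 * Real.pi * ξ : ℝ) : ℂ) * p.1) * Complex.I) * fourier (-n) p.2) := by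
    funext ξ
    rw [fourierIntegral, mul_assoc, ← integral_mul_const]
    congr 1
    refine integral_congr_ae (Filter.Eventually.of_forall fun p => ?_)
    simp only
    ring
  rw [e]
  refine ⟨hint.integral_prod_left.const_mul _, ?_⟩
  rw [integral_const_mul, integral_integral_swap hint]
  congr 1
  refine integral_congr_ae (Filter.Eventually.of_forall fun p => ?_)
  simp only [TestFunction.tensor, SchwartzMap.fourier_coe, Real.fourier_real_eq_integral_exp_smul]
  rw [← integral_mul_const, ← integral_const_mul]
  refine integral_congr_ae (Filter.Eventually.of_forall fun ξ => ?_)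
  simp only [smul_eq_mul]
  have : ((-2 * Real.pi * ξ * p.1 : ℝ) : ℂ) * Complex.I
      = -(((2 * Real.pi * ξ : ℝ) : ℂ) * p.1) * Complex.I := by
    push_cast
    ring
  rw [this]
  ring

/-- The Fourier transform of a product is dominated by the convolution of the absolute values of
the Fourier transforms. -/
theorem enorm_fourierIntegral_mul_le {u v : ℝ × AddCircle L → ℂ} (hu : MemLp u 2)
    (hv : MemLp v 2) {F G : ℤ → ℝ → ℂ} (hF : HasFourierTransform (ofFun u) F)
    (hG : HasFourierTransform (ofFun v) G) (n : ℤ) (τ : ℝ) :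
    ‖fourierIntegral (fun p => u p * v p) n τ‖ₑ
      ≤ ∑' k : ℤ, ∫⁻ σ, ‖F k σ‖ₑ * ‖G (n - k) (τ - σ)‖ₑ := by
  have h := enorm_integral_mul_le hu (memLp_modulation hv n τ) hF (hG.modulation n τ)
  simp only [← sub_eq_add_neg, ← mul_assoc] at h
  -- The factor L from Parseval cancels L⁻¹ in the normalization. What remains is (2π)^(-1/2) ≤ 1,
  -- so no constant appears and no dependence on L.
  have hs : 1 ≤ Real.sqrt (2 * Real.pi) := by
    rw [Real.one_le_sqrt]
    linarith [Real.pi_gt_three]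
  have hc : (Real.sqrt (2 * Real.pi) * L)⁻¹ ≤ L⁻¹ :=
    inv_anti₀ hL.out (le_mul_of_one_le_left hL.out.le hs)
  have hc' : ‖(((Real.sqrt (2 * Real.pi) * L)⁻¹ : ℝ) : ℂ)‖ₑ ≤ ENNReal.ofReal L⁻¹ := by
    rw [← ofReal_norm, Complex.norm_real,
      Real.norm_of_nonneg (inv_nonneg.2 (mul_nonneg (Real.sqrt_nonneg _) hL.out.le))]
    exact ENNReal.ofReal_le_ofReal hc
  rw [fourierIntegral, enorm_mul]
  simp only [← mul_assoc]
  refine (mul_le_mul' hc' h).trans_eq ?_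
  rw [← mul_assoc, ← ENNReal.ofReal_mul (inv_nonneg.2 hL.out.le), inv_mul_cancel₀ hL.out.ne',
    ENNReal.ofReal_one, one_mul]

theorem HasFourierTransform.conj {v : ℝ × AddCircle L → ℂ} {F : ℤ → ℝ → ℂ}
    (h : HasFourierTransform (ofFun v) F) :
    HasFourierTransform (ofFun fun p => (starRingEnd ℂ) (v p))
      (fun n τ => (starRingEnd ℂ) (F (-n) (-τ))) := by
  intro n χ
  obtain ⟨h1, h2⟩ := h (-n) (conjReflect χ)
  have e : (fun ξ => (starRingEnd ℂ) (F (-n) (-(2 * Real.pi * ξ))) * χ ξ)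
      = fun ξ => (starRingEnd ℂ)
        ((fun ξ => F (-n) (2 * Real.pi * ξ) * conjReflect χ ξ) (-ξ)) := by
    funext ξ
    simp [conjReflect_apply]
  refine ⟨?_, ?_⟩
  · rw [e]
    exact (LinearIsometryEquiv.integrable_comp_iff (Complex.conjLIE)).2 h1.comp_neg
  · rw [e, integral_conj, integral_neg_eq_self
      (fun ξ => F (-n) (2 * Real.pi * ξ) * conjReflect χ ξ), h2, map_mul, Complex.conj_ofReal]
    congr 1
    rw [ofFun, ofFun, ← integral_conj]
    refine integral_congr_ae (Filter.Eventually.of_forall fun p => ?_)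
    simp only [TestFunction.tensor, fourier_conjReflect, map_mul, Complex.conj_conj,
      ← fourier_neg, neg_neg]

theorem HasFourierTransform.dx {w : ℝ × AddCircle L → ℂ} {F : ℤ → ℝ → ℂ}
    (h : HasFourierTransform (ofFun w) F) :
    HasFourierTransform (ofFun w).dx
      (fun n τ => (2 * Real.pi * Complex.I * n / L) * F n τ) := by
  intro n χ
  obtain ⟨h1, h2⟩ := h n χ
  simp only [mul_assoc (2 * Real.pi * Complex.I * n / L : ℂ)]
  refine ⟨h1.const_mul _, ?_⟩
  rw [integral_const_mul, h2, ← mul_assoc, mul_comm (2 * Real.pi * Complex.I * n / L : ℂ),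
    mul_assoc]
  congr 1
  rw [Functional.dx, ofFun, ofFun, ← integral_const_mul, ← integral_neg]
  refine integral_congr_ae (Filter.Eventually.of_forall fun p => ?_)
  simp only [spaceDeriv_tensor]
  push_cast
  ring

end

/-! ### Weighted trilinear forms on an abelian group -/

section Trilinear

theorem sq_lintegral_mul_le {α : Type*} [MeasurableSpace α] (μ : Measure α) {f g : α → ℝ≥0∞}
    (hf : Measurable f) (hg : Measurable g) :
    (∫⁻ x, f x * g x ∂μ) ^ 2 ≤ (∫⁻ x, f x ^ 2 ∂μ) * ∫⁻ x, g x ^ 2 ∂μ := by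
  have h := ENNReal.lintegral_mul_le_Lp_mul_Lq μ Real.HolderConjugate.two_two hf.aemeasurable
    hg.aemeasurable
  simp only [ENNReal.rpow_two, Pi.mul_apply] at h
  calc (∫⁻ x, f x * g x ∂μ) ^ 2
      ≤ ((∫⁻ x, f x ^ 2 ∂μ) ^ (1 / 2 : ℝ) * (∫⁻ x, g x ^ 2 ∂μ) ^ (1 / 2 : ℝ)) ^ 2 := by gcongr
    _ = _ := by
      rw [mul_pow, ← ENNReal.rpow_two, ← ENNReal.rpow_two, ← ENNReal.rpow_mul, ← ENNReal.rpow_mul]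
      norm_num

/-- A function with bounded pairings against `L²` is in `L²`. -/
theorem lintegral_sq_le_of_forall_pairing {α : Type*} [MeasurableSpace α] (μ : Measure α)
    [SigmaFinite μ] {k : α → ℝ≥0∞} (A : ℝ≥0∞)
    (h : ∀ g : α → ℝ≥0∞, Measurable g → (∫⁻ x, k x * g x ∂μ) ^ 2 ≤ A * ∫⁻ x, g x ^ 2 ∂μ) :
    ∫⁻ x, k x ^ 2 ∂μ ≤ A := by
  refine le_of_forall_lt fun c hc => ?_
  rw [lintegral_eq_nnreal] at hc
  simp only [lt_iSup_iff] at hc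
  obtain ⟨φ₀, hφ₀, hc⟩ := hc
  rw [← SimpleFunc.lintegral_eq_lintegral] at hc
  -- The simple function φ lies below k² and has finite integral. Testing with φ^(1/2) gives (∫ φ)²
  -- ≤ A ∫ φ, and finiteness allows cancelling one factor.
  obtain ⟨φ, hφ, hφ2, hφ3⟩ :=
    SimpleFunc.exists_lt_lintegral_simpleFunc_of_lt_lintegral (f := φ₀) hc
  have hφ1 : ∀ x, (φ x : ℝ≥0∞) ≤ k x ^ 2 := fun x =>
    (ENNReal.coe_le_coe.2 (hφ x)).trans (hφ₀ x)
  refine hφ3.trans_le ?_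
  have hg : Measurable fun x => ((φ x : ℝ≥0∞)) ^ (1 / 2 : ℝ) := by
    exact (φ.measurable.coe_nnreal_ennreal).pow_const _
  have hsq : ∀ x, (((φ x : ℝ≥0∞)) ^ (1 / 2 : ℝ)) ^ 2 = φ x := fun x => by
    rw [← ENNReal.rpow_two, ← ENNReal.rpow_mul]
    norm_num
  have h1 := h _ hg
  simp only [hsq] at h1
  have h2 : ∫⁻ x, φ x ∂μ ≤ ∫⁻ x, k x * ((φ x : ℝ≥0∞)) ^ (1 / 2 : ℝ) ∂μ := by
    refine lintegral_mono fun x => ?_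
    have h3 : ((φ x : ℝ≥0∞)) ^ (1 / 2 : ℝ) ≤ k x := by
      have := ENNReal.rpow_le_rpow (hφ1 x) (by norm_num : (0 : ℝ) ≤ 1 / 2)
      refine this.trans_eq ?_
      rw [← ENNReal.rpow_two, ← ENNReal.rpow_mul]
      norm_num
    calc (φ x : ℝ≥0∞) = ((φ x : ℝ≥0∞)) ^ (1 / 2 : ℝ) * ((φ x : ℝ≥0∞)) ^ (1 / 2 : ℝ) := by
          rw [← sq, hsq]
      _ ≤ _ := by gcongr
  have h4 : (∫⁻ x, φ x ∂μ) * ∫⁻ x, φ x ∂μ ≤ A * ∫⁻ x, φ x ∂μ := by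
    rw [← sq]
    exact (pow_le_pow_left' h2 2).trans h1
  rcases eq_or_ne (∫⁻ x, (φ x : ℝ≥0∞) ∂μ) 0 with h0 | h0
  · simp [h0]
  · exact (ENNReal.mul_le_mul_iff_left h0 hφ2.ne).1 h4

/-- Cauchy–Schwarz in x for fixed y: the kernel `P` only needs a bounded L² norm in x, uniformly in
y. -/
theorem lintegral_sq_lintegral_mul_le {α β : Type*} [MeasurableSpace α] [MeasurableSpace β]
    (μ : Measure α) (ν : Measure β) {P A : α → β → ℝ≥0∞}
    (hP : Measurable (Function.uncurry P)) (hA : Measurable (Function.uncurry A)) [SFinite μ]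
    (C : ℝ≥0∞) (hC : ∀ y, ∫⁻ x, P x y ^ 2 ∂μ ≤ C) :
    ∫⁻ y, (∫⁻ x, P x y * A x y ∂μ) ^ 2 ∂ν ≤ C * ∫⁻ y, ∫⁻ x, A x y ^ 2 ∂μ ∂ν := by
  rw [← lintegral_const_mul _ (by exact (hA.pow_const 2).lintegral_prod_left')]
  refine lintegral_mono fun y => ?_
  refine (sq_lintegral_mul_le μ (hP.of_uncurry_right) (hA.of_uncurry_right)).trans ?_
  gcongr
  exact hC y

variable {G : Type*} [AddCommGroup G] [MeasurableSpace G] (μ : Measure G)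

/-- The convolution of two nonnegative functions. -/
def conv (f g : G → ℝ≥0∞) (z : G) : ℝ≥0∞ := ∫⁻ x, f x * g (z - x) ∂μ

/-- The correlation of two nonnegative functions. -/
def corr (f h : G → ℝ≥0∞) (y : G) : ℝ≥0∞ := ∫⁻ x, f x * h (x + y) ∂μ

/-- The trilinear form `∫∫ f(x) g(y) h(x + y)`. -/
def trilinear (f g h : G → ℝ≥0∞) : ℝ≥0∞ := ∫⁻ x, ∫⁻ y, f x * g y * h (x + y) ∂μ ∂μ

theorem measurable_conv [SFinite μ] [MeasurableSub₂ G] {f g : G → ℝ≥0∞} (hf : Measurable f) (hg : Measurable g) :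
    Measurable (conv μ f g) := by
  have h : Measurable fun p : G × G => f p.1 * g (p.2 - p.1) := by fun_prop
  exact h.lintegral_prod_left'

theorem measurable_corr [SFinite μ] [MeasurableAdd₂ G] {f h : G → ℝ≥0∞} (hf : Measurable f) (hh : Measurable h) :
    Measurable (corr μ f h) := by
  have h : Measurable fun p : G × G => f p.1 * h (p.1 + p.2) := by fun_prop
  exact h.lintegral_prod_left'

theorem trilinear_eq_corr_snd [SFinite μ] [MeasurableAdd₂ G] {f g h : G → ℝ≥0∞}
    (hf : Measurable f) (hg : Measurable g) (hh : Measurable h) : trilinear μ f g h = ∫⁻ y, g y * corr μ f h y ∂μ := by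
  rw [trilinear, lintegral_lintegral_swap (by fun_prop)]
  refine lintegral_congr fun y => ?_
  rw [corr, ← lintegral_const_mul _ (by fun_prop)]
  refine lintegral_congr fun x => ?_
  ring

theorem trilinear_eq_corr_fst [MeasurableAdd₂ G] {f g h : G → ℝ≥0∞} (hg : Measurable g)
    (hh : Measurable h) : trilinear μ f g h = ∫⁻ x, f x * corr μ g h x ∂μ := by
  refine lintegral_congr fun x => ?_
  rw [corr, ← lintegral_const_mul _ (by fun_prop)]
  refine lintegral_congr fun y => ?_
  rw [add_comm x y, mul_assoc]

theorem lintegral_corr_sq_le [SFinite μ] [MeasurableAdd₂ G] [μ.IsAddRightInvariant]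
    {f h p r : G → ℝ≥0∞} (hf : Measurable f) (hh : Measurable h)
    (hp : Measurable p) (hr : Measurable r) (C : ℝ≥0∞) (hC : ∀ z, corr μ (p ^ 2) (r ^ 2) z ≤ C) :
    ∫⁻ z, corr μ (p * f) (r * h) z ^ 2 ∂μ
      ≤ C * ((∫⁻ x, f x ^ 2 ∂μ) * ∫⁻ x, h x ^ 2 ∂μ) := by
  have h' := lintegral_sq_lintegral_mul_le μ μ (P := fun x z => p x * r (x + z))
    (A := fun x z => f x * h (x + z)) (by fun_prop) (by fun_prop) C
    (fun z => by simp only [mul_pow]; exact hC z)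
  calc _ = _ := lintegral_congr fun z => by
          rw [corr]
          congr 1
          refine lintegral_congr fun x => ?_
          simp only [Pi.mul_apply]
          ring
    _ ≤ _ := h'
    _ = _ := by
      rw [lintegral_lintegral_swap (by fun_prop), ← lintegral_mul_const _ (by fun_prop)]
      congr 1
      refine lintegral_congr fun x => ?_
      simp only [mul_pow, add_comm x]
      rw [lintegral_const_mul _ (by fun_prop), lintegral_add_right_eq_self (fun z => h z ^ 2) x]

theorem sq_trilinear_corr_le [SFinite μ] [MeasurableAdd₂ G] [μ.IsAddRightInvariant]
    {f g h p r : G → ℝ≥0∞} (hf : Measurable f) (hg : Measurable g) (hh : Measurable h) (hp : Measurable p) (hr : Measurable r) (C : ℝ≥0∞)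
    (hC : ∀ z, corr μ (p ^ 2) (r ^ 2) z ≤ C) :
    trilinear μ (p * f) g (r * h) ^ 2
      ≤ C * ((∫⁻ x, f x ^ 2 ∂μ) * (∫⁻ x, g x ^ 2 ∂μ) * ∫⁻ x, h x ^ 2 ∂μ) := by
  rw [trilinear_eq_corr_snd μ (hp.mul hf) hg (hr.mul hh)]
  refine (sq_lintegral_mul_le μ hg (measurable_corr μ (hp.mul hf) (hr.mul hh))).trans ?_
  calc _ ≤ (∫⁻ x, g x ^ 2 ∂μ) * (C * ((∫⁻ x, f x ^ 2 ∂μ) * ∫⁻ x, h x ^ 2 ∂μ)) := by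
        gcongr
        exact lintegral_corr_sq_le μ hf hh hp hr C hC
    _ = _ := by ring

variable [SFinite μ] [MeasurableAdd₂ G] [MeasurableSub₂ G] [μ.IsAddRightInvariant]

theorem trilinear_eq_conv {f g h : G → ℝ≥0∞} (hf : Measurable f) (hg : Measurable g)
    (hh : Measurable h) : trilinear μ f g h = ∫⁻ z, conv μ f g z * h z ∂μ := by
  have e : ∀ x, ∫⁻ y, f x * g y * h (x + y) ∂μ = ∫⁻ z, f x * g (z - x) * h z ∂μ := by
    intro x
    rw [← lintegral_sub_right_eq_self (fun y => f x * g y * h (x + y)) x]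
    simp
  simp only [trilinear, e]
  rw [lintegral_lintegral_swap (by fun_prop)]
  refine lintegral_congr fun z => ?_
  rw [conv, ← lintegral_mul_const _ (by fun_prop)]

theorem lintegral_conv_sq_le {f g p q : G → ℝ≥0∞} (hf : Measurable f) (hg : Measurable g)
    (hp : Measurable p) (hq : Measurable q) (C : ℝ≥0∞) (hC : ∀ z, conv μ (p ^ 2) (q ^ 2) z ≤ C) :
    ∫⁻ z, conv μ (p * f) (q * g) z ^ 2 ∂μ
      ≤ C * ((∫⁻ x, f x ^ 2 ∂μ) * ∫⁻ x, g x ^ 2 ∂μ) := by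
  have h := lintegral_sq_lintegral_mul_le μ μ (P := fun x z => p x * q (z - x))
    (A := fun x z => f x * g (z - x)) (by fun_prop) (by fun_prop) C
    (fun z => by simp only [mul_pow]; exact hC z)
  calc _ = _ := lintegral_congr fun z => by
          rw [conv]
          congr 1
          refine lintegral_congr fun x => ?_
          simp only [Pi.mul_apply]
          ring
    _ ≤ _ := h
    _ = _ := by
      rw [lintegral_lintegral_swap (by fun_prop), ← lintegral_mul_const _ (by fun_prop)]
      congr 1
      refine lintegral_congr fun x => ?_
      simp only [mul_pow]
      rw [lintegral_const_mul _ (by fun_prop), lintegral_sub_right_eq_self (fun z => g z ^ 2) x]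

/-- The `L²` norm of a product does not change if one factor is conjugated. -/
theorem lintegral_corr_sq_eq_conv_sq {g h : G → ℝ≥0∞} (hg : Measurable g) (hh : Measurable h) :
    ∫⁻ z, corr μ g h z ^ 2 ∂μ = ∫⁻ z, conv μ g h z ^ 2 ∂μ := by
  have e1 : ∀ z, corr μ g h z ^ 2
      = ∫⁻ y, ∫⁻ w, (g y * h (y + z)) * (g w * h (w + z)) ∂μ ∂μ := fun z => by
    rw [sq, corr, ← lintegral_mul_const _ (by fun_prop)]
    exact lintegral_congr fun y => (lintegral_const_mul _ (by fun_prop)).symm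
  have e2 : ∀ z, conv μ g h z ^ 2
      = ∫⁻ y, ∫⁻ w, (g y * h (z - y)) * (g w * h (z - w)) ∂μ ∂μ := fun z => by
    rw [sq, conv, ← lintegral_mul_const _ (by fun_prop)]
    exact lintegral_congr fun y => (lintegral_const_mul _ (by fun_prop)).symm
  have m1 : Measurable fun t : (G × G) × G =>
      (g t.1.2 * h (t.1.2 + t.1.1)) * (g t.2 * h (t.2 + t.1.1)) := by fun_prop
  have m2 : Measurable fun t : (G × G) × G =>
      (g t.1.2 * h (t.1.1 - t.1.2)) * (g t.2 * h (t.1.1 - t.2)) := by fun_prop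
  calc ∫⁻ z, corr μ g h z ^ 2 ∂μ
      = ∫⁻ y, ∫⁻ z, ∫⁻ w, (g y * h (y + z)) * (g w * h (w + z)) ∂μ ∂μ ∂μ := by
        simp only [e1]
        exact lintegral_lintegral_swap (by exact m1.lintegral_prod_right'.aemeasurable)
    -- The translation z ↦ z − y brings the square of the correlation to a form that coincides,
    -- after exchanging y and w, with what z ↦ z + y gives for the square of the convolution.
    _ = ∫⁻ y, ∫⁻ w, ∫⁻ z, g y * g w * (h z * h (z + w - y)) ∂μ ∂μ ∂μ := by
        refine lintegral_congr fun y => ?_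
        rw [lintegral_lintegral_swap (by fun_prop)]
        refine lintegral_congr fun w => ?_
        rw [← lintegral_sub_right_eq_self _ y]
        refine lintegral_congr fun z => ?_
        rw [add_sub_cancel, ← add_sub_assoc, add_comm w z]
        ring
    _ = ∫⁻ w, ∫⁻ y, ∫⁻ z, g y * g w * (h z * h (z + w - y)) ∂μ ∂μ ∂μ := by
        have m3 : Measurable fun t : (G × G) × G =>
          g t.1.1 * g t.1.2 * (h t.2 * h (t.2 + t.1.2 - t.1.1)) := by fun_prop
        exact lintegral_lintegral_swap (by exact m3.lintegral_prod_right'.aemeasurable)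
    _ = ∫⁻ y, ∫⁻ z, ∫⁻ w, (g y * h (z - y)) * (g w * h (z - w)) ∂μ ∂μ ∂μ := by
        refine lintegral_congr fun y => ?_
        rw [lintegral_lintegral_swap (by fun_prop)]
        rw [← lintegral_sub_right_eq_self _ y]
        refine lintegral_congr fun z => lintegral_congr fun w => ?_
        rw [sub_add_cancel]
        ring
    _ = _ := by
        simp only [e2]
        exact (lintegral_lintegral_swap (by exact m2.lintegral_prod_right'.aemeasurable)).symm

theorem sq_trilinear_conv_le {f g h p q : G → ℝ≥0∞} (hf : Measurable f) (hg : Measurable g)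
    (hh : Measurable h) (hp : Measurable p) (hq : Measurable q) (C : ℝ≥0∞)
    (hC : ∀ z, conv μ (p ^ 2) (q ^ 2) z ≤ C) :
    trilinear μ (p * f) (q * g) h ^ 2
      ≤ C * ((∫⁻ x, f x ^ 2 ∂μ) * (∫⁻ x, g x ^ 2 ∂μ) * ∫⁻ x, h x ^ 2 ∂μ) := by
  rw [trilinear_eq_conv μ (hp.mul hf) (hq.mul hg) hh]
  refine (sq_lintegral_mul_le μ (measurable_conv μ (hp.mul hf) (hq.mul hg)) hh).trans ?_
  rw [← mul_assoc]
  gcongr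
  exact lintegral_conv_sq_le μ hf hg hp hq C hC

/-- Pairing with f produces a correlation of the other two factors. Its L² norm equals that of their
convolution, so the hypothesis concerns `conv` rather than `corr` of the weights; for two
Schrödinger weights only the former is bounded. -/
theorem sq_trilinear_conv_conj_le {f g h q r : G → ℝ≥0∞} (hf : Measurable f) (hg : Measurable g)
    (hh : Measurable h) (hq : Measurable q) (hr : Measurable r) (C : ℝ≥0∞)
    (hC : ∀ z, conv μ (q ^ 2) (r ^ 2) z ≤ C) :
    trilinear μ f (q * g) (r * h) ^ 2
      ≤ C * ((∫⁻ x, f x ^ 2 ∂μ) * (∫⁻ x, g x ^ 2 ∂μ) * ∫⁻ x, h x ^ 2 ∂μ) := by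
  rw [trilinear_eq_corr_fst μ (hq.mul hg) (hr.mul hh)]
  refine (sq_lintegral_mul_le μ hf (measurable_corr μ (hq.mul hg) (hr.mul hh))).trans ?_
  rw [lintegral_corr_sq_eq_conv_sq μ (hq.mul hg) (hr.mul hh)]
  calc _ ≤ (∫⁻ x, f x ^ 2 ∂μ) * (C * ((∫⁻ x, g x ^ 2 ∂μ) * ∫⁻ x, h x ^ 2 ∂μ)) := by
        gcongr
        exact lintegral_conv_sq_le μ hg hh hq hr C hC
    _ = _ := by ring

theorem sq_add_three_le {a b c X : ℝ≥0∞} (ha : a ^ 2 ≤ X) (hb : b ^ 2 ≤ X) (hc : c ^ 2 ≤ X) :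
    (a + b + c) ^ 2 ≤ 9 * X := by
  obtain ⟨m, hm, h1, h2, h3⟩ : ∃ m : ℝ≥0∞, m ^ 2 ≤ X ∧ a ≤ m ∧ b ≤ m ∧ c ≤ m := by
    refine ⟨max a (max b c), ?_, le_max_left _ _, (le_max_left _ _).trans (le_max_right _ _),
      (le_max_right _ _).trans (le_max_right _ _)⟩
    rcases max_choice a (max b c) with h | h <;> rw [h]
    · exact ha
    · rcases max_choice b c with h | h <;> rw [h] <;> assumption
  calc (a + b + c) ^ 2 ≤ (m + m + m) ^ 2 := by gcongr
    _ = 9 * m ^ 2 := by ring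
    _ ≤ 9 * X := by gcongr

/-- A trilinear form whose integrand is controlled by three terms, in each of which two of the
three factors carry a weight, is bounded on `L²`. -/
theorem sq_trilinear_le_of_le {f g h p q r f₀ g₀ h₀ : G → ℝ≥0∞} (hf : Measurable f)
    (hg : Measurable g) (hh : Measurable h) (hp : Measurable p) (hq : Measurable q)
    (hr : Measurable r) (C D : ℝ≥0∞)
    (h1 : ∀ z, conv μ (p ^ 2) (q ^ 2) z ≤ C) (h2 : ∀ z, corr μ (p ^ 2) (r ^ 2) z ≤ C)
    (h3 : ∀ z, conv μ (q ^ 2) (r ^ 2) z ≤ C)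
    (hle : ∀ x y, f₀ x * g₀ y * h₀ (x + y) ≤ D * (f x * g y * h (x + y)
      * (p x * q y + p x * r (x + y) + q y * r (x + y)))) :
    trilinear μ f₀ g₀ h₀ ^ 2
      ≤ D ^ 2 * (9 * C) * ((∫⁻ x, f x ^ 2 ∂μ) * (∫⁻ x, g x ^ 2 ∂μ) * ∫⁻ x, h x ^ 2 ∂μ) := by
  have key : trilinear μ f₀ g₀ h₀ ≤ D * (trilinear μ (p * f) (q * g) h
      + trilinear μ (p * f) g (r * h) + trilinear μ f (q * g) (r * h)) := by
    have m1 : Measurable fun t : G × G => (p * f) t.1 * (q * g) t.2 * h (t.1 + t.2) :=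
      ((hp.mul hf).comp measurable_fst).mul ((hq.mul hg).comp measurable_snd) |>.mul
        (hh.comp measurable_add)
    have m2 : Measurable fun t : G × G => (p * f) t.1 * g t.2 * (r * h) (t.1 + t.2) :=
      ((hp.mul hf).comp measurable_fst).mul (hg.comp measurable_snd) |>.mul
        ((hr.mul hh).comp measurable_add)
    have m3 : Measurable fun t : G × G => f t.1 * (q * g) t.2 * (r * h) (t.1 + t.2) :=
      (hf.comp measurable_fst).mul ((hq.mul hg).comp measurable_snd) |>.mul
        ((hr.mul hh).comp measurable_add)
    have e : D * (trilinear μ (p * f) (q * g) h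
        + trilinear μ (p * f) g (r * h) + trilinear μ f (q * g) (r * h))
        = ∫⁻ x, ∫⁻ y, D * ((p * f) x * (q * g) y * h (x + y)
          + (p * f) x * g y * (r * h) (x + y) + f x * (q * g) y * (r * h) (x + y)) ∂μ ∂μ := by
      simp only [trilinear]
      rw [lintegral_lintegral m1.aemeasurable, lintegral_lintegral m2.aemeasurable,
        lintegral_lintegral m3.aemeasurable, ← lintegral_add_left m1,
        ← lintegral_add_right _ m3, ← lintegral_const_mul _ (by exact (m1.add m2).add m3),
        lintegral_lintegral (by exact (((m1.add m2).add m3).const_mul D).aemeasurable)]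
    rw [e]
    refine lintegral_mono fun x => lintegral_mono fun y => (hle x y).trans_eq ?_
    simp only [Pi.mul_apply]
    ring
  refine (pow_le_pow_left' key 2).trans ?_
  rw [mul_pow, mul_assoc, mul_assoc]
  gcongr
  exact sq_add_three_le (sq_trilinear_conv_le μ hf hg hh hp hq C h1)
    (sq_trilinear_corr_le μ hf hg hh hp hr C h2) (sq_trilinear_conv_conj_le μ hf hg hh hq hr C h3)

end Trilinear

/-! ### Integrals and lattice sums of the weights -/

theorem one_le_japanese (x : ℝ) : 1 ≤ japanese x := by
  simp [japanese]

theorem japanese_pos (x : ℝ) : 0 < japanese x := one_pos.trans_le (one_le_japanese x)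

theorem measurable_japanese : Measurable japanese := by
  unfold japanese
  fun_prop

theorem japanese_sub_le (x a b : ℝ) : japanese (a - b) ≤ japanese (x + a) + japanese (x + b) := by
  have h : |a - b| ≤ |x + a| + |x + b| := by
    have := abs_sub (x + a) (x + b)
    simpa using this
  simp only [japanese]
  linarith

/-- The total exponent 7/8 + 7/8 is redistributed as 5/8 + 9/8. The larger factor is at least D/2
and yields the decay in D; the remaining power 9/8 > 1 of the smaller one is integrable. -/
theorem rpow_mul_rpow_le {A B D : ℝ} (hA : 0 < A) (hD : 0 < D) (hAB : A ≤ B) (hDAB : D ≤ A + B) :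
    A ^ (-7 / 8 : ℝ) * B ^ (-7 / 8 : ℝ) ≤ 2 * D ^ (-5 / 8 : ℝ) * A ^ (-9 / 8 : ℝ) := by
  have hB : 0 < B := hA.trans_le hAB
  have e1 : B ^ (-7 / 8 : ℝ) = B ^ (-5 / 8 : ℝ) * B ^ (-1 / 4 : ℝ) := by
    rw [← Real.rpow_add hB]; norm_num
  have e2 : A ^ (-9 / 8 : ℝ) = A ^ (-7 / 8 : ℝ) * A ^ (-1 / 4 : ℝ) := by
    rw [← Real.rpow_add hA]; norm_num
  have h1 : B ^ (-1 / 4 : ℝ) ≤ A ^ (-1 / 4 : ℝ) :=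
    Real.rpow_le_rpow_of_nonpos hA hAB (by norm_num)
  have h2 : B ^ (-5 / 8 : ℝ) ≤ 2 * D ^ (-5 / 8 : ℝ) := by
    have h3 : B ^ (-5 / 8 : ℝ) ≤ (D / 2) ^ (-5 / 8 : ℝ) :=
      Real.rpow_le_rpow_of_nonpos (by positivity) (by linarith) (by norm_num)
    have h4 : (D / 2) ^ (-5 / 8 : ℝ) = D ^ (-5 / 8 : ℝ) * 2 ^ (5 / 8 : ℝ) := by
      rw [Real.div_rpow hD.le (by norm_num), div_eq_mul_inv, ← Real.rpow_neg (by norm_num)]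
      norm_num
    have h5 : (2 : ℝ) ^ (5 / 8 : ℝ) ≤ 2 := by
      conv_rhs => rw [← Real.rpow_one 2]
      exact Real.rpow_le_rpow_of_exponent_le (by norm_num) (by norm_num)
    rw [h4] at h3
    refine h3.trans ?_
    rw [mul_comm]
    gcongr
  rw [e1, e2]
  calc A ^ (-7 / 8 : ℝ) * (B ^ (-5 / 8 : ℝ) * B ^ (-1 / 4 : ℝ))
      ≤ A ^ (-7 / 8 : ℝ) * ((2 * D ^ (-5 / 8 : ℝ)) * A ^ (-1 / 4 : ℝ)) := by gcongr
    _ = _ := by ring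

theorem rpow_mul_rpow_le_add {A B D : ℝ} (hA : 0 < A) (hB : 0 < B) (hD : 0 < D)
    (hDAB : D ≤ A + B) :
    A ^ (-7 / 8 : ℝ) * B ^ (-7 / 8 : ℝ)
      ≤ 2 * D ^ (-5 / 8 : ℝ) * (A ^ (-9 / 8 : ℝ) + B ^ (-9 / 8 : ℝ)) := by
  rcases le_total A B with h | h
  · refine (rpow_mul_rpow_le hA hD h hDAB).trans ?_
    gcongr
    exact le_add_of_nonneg_right (by positivity)
  · rw [mul_comm]
    refine (rpow_mul_rpow_le hB hD h (by linarith)).trans ?_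
    gcongr
    exact le_add_of_nonneg_left (by positivity)

/-- The constant in the integral bound for products of modulation weights. -/
def weightConst : ℝ≥0∞ := 4 * ∫⁻ x : ℝ, ENNReal.ofReal (japanese x ^ (-9 / 8 : ℝ))

theorem weightConst_ne_top : weightConst ≠ ∞ := by
  have h : Integrable (fun x : ℝ => (1 + ‖x‖) ^ (-(9 / 8) : ℝ)) :=
    integrable_one_add_norm (by simp; norm_num)
  refine ENNReal.mul_ne_top (by norm_num) ?_
  have := h.lintegral_lt_top
  simp only [Real.norm_eq_abs] at this
  simp only [japanese]
  norm_num at this ⊢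
  exact this.ne

theorem lintegral_weight_mul_le (a b : ℝ) :
    ∫⁻ x : ℝ, ENNReal.ofReal (japanese (x + a) ^ (-7 / 8 : ℝ))
        * ENNReal.ofReal (japanese (x + b) ^ (-7 / 8 : ℝ))
      ≤ weightConst * ENNReal.ofReal (japanese (a - b) ^ (-5 / 8 : ℝ)) := by
  have hm : Measurable fun x : ℝ => ENNReal.ofReal (japanese x ^ (-9 / 8 : ℝ)) :=
    (measurable_japanese.pow_const _).ennreal_ofReal
  have hpt : ∀ x : ℝ, ENNReal.ofReal (japanese (x + a) ^ (-7 / 8 : ℝ))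
        * ENNReal.ofReal (japanese (x + b) ^ (-7 / 8 : ℝ))
      ≤ (2 * ENNReal.ofReal (japanese (a - b) ^ (-5 / 8 : ℝ)))
        * (ENNReal.ofReal (japanese (x + a) ^ (-9 / 8 : ℝ))
          + ENNReal.ofReal (japanese (x + b) ^ (-9 / 8 : ℝ))) := by
    intro x
    have p1 := japanese_pos (x + a)
    have p2 := japanese_pos (x + b)
    have p3 := japanese_pos (a - b)
    have e2 : (2 : ℝ≥0∞) = ENNReal.ofReal 2 := by simp
    rw [e2, ← ENNReal.ofReal_mul (by positivity), ← ENNReal.ofReal_mul (by positivity),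
      ← ENNReal.ofReal_add (by positivity) (by positivity), ← ENNReal.ofReal_mul (by positivity)]
    exact ENNReal.ofReal_le_ofReal (rpow_mul_rpow_le_add p1 p2 p3 (japanese_sub_le x a b))
  refine (lintegral_mono hpt).trans_eq ?_
  have hm' : ∀ c : ℝ, Measurable fun x : ℝ =>
      ENNReal.ofReal (japanese (x + c) ^ (-9 / 8 : ℝ)) := fun c => hm.comp (measurable_add_const c)
  rw [lintegral_const_mul _ (by exact (hm' a).add (hm' b)), lintegral_add_left (hm' a),
    lintegral_add_right_eq_self (fun x => ENNReal.ofReal (japanese x ^ (-9 / 8 : ℝ))) a,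
    lintegral_add_right_eq_self (fun x => ENNReal.ofReal (japanese x ^ (-9 / 8 : ℝ))) b,
    weightConst]
  ring

/-- `∑ₙ ⟨n⟩^(-5/4)`, up to a factor. -/
def latticeConst : ℝ≥0∞ := 4 * ∑' k : ℤ, ENNReal.ofReal (japanese k ^ (-5 / 4 : ℝ))

theorem latticeConst_ne_top : latticeConst ≠ ∞ := by
  refine ENNReal.mul_ne_top (by norm_num) ?_
  have h1 : Summable fun k : ℤ => |(k : ℝ)| ^ (-(5 / 4) : ℝ) :=
    Real.summable_abs_int_rpow (by norm_num)
  have h2 : Summable fun k : ℤ => (if k = 0 then (1 : ℝ) else 0) :=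
    summable_of_hasFiniteSupport (Set.Finite.subset (Set.finite_singleton (0 : ℤ))
      (by intro k; simp))
  have h3 : Summable fun k : ℤ => japanese k ^ (-5 / 4 : ℝ) := by
    refine Summable.of_nonneg_of_le (fun k => Real.rpow_nonneg (japanese_pos _).le _)
      (fun k => ?_) (h1.add h2)
    rcases eq_or_ne k 0 with rfl | hk
    · simp [japanese]
    · simp only [hk, if_false, add_zero, japanese]
      rw [neg_div]
      exact Real.rpow_le_rpow_of_nonpos (by positivity) (by linarith) (by norm_num)
  rw [← ENNReal.ofReal_tsum_of_nonneg (fun k => Real.rpow_nonneg (japanese_pos _).le _) h3]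
  exact ENNReal.ofReal_ne_top

/-- Shifting by ⌊a⌋ reduces to a ∈ [0, 1), where ⟨k + a⟩ ≥ ⟨k⟩/2. The loss 2^(5/4) is absorbed by
the 4 in `latticeConst`, so the bound is uniform in a. -/
theorem tsum_japanese_add_le (a : ℝ) :
    ∑' k : ℤ, ENNReal.ofReal (japanese (k + a) ^ (-5 / 4 : ℝ)) ≤ latticeConst := by
  rw [← (Equiv.subRight ⌊a⌋).tsum_eq, latticeConst, ← ENNReal.tsum_mul_left]
  refine ENNReal.tsum_le_tsum fun k => ?_
  have e4 : (4 : ℝ≥0∞) = ENNReal.ofReal 4 := by simp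
  rw [e4, ← ENNReal.ofReal_mul (by norm_num)]
  refine ENNReal.ofReal_le_ofReal ?_
  have e : (((Equiv.subRight ⌊a⌋) k : ℤ) : ℝ) + a = k + Int.fract a := by
    simp only [Equiv.subRight_apply, Int.cast_sub, Int.fract]
    ring
  rw [e]
  have h0 := Int.fract_nonneg a
  have h1 := Int.fract_lt_one a
  have h2 : japanese (k : ℝ) / 2 ≤ japanese ((k : ℝ) + Int.fract a) := by
    simp only [japanese]
    have := abs_sub ((k : ℝ) + Int.fract a) (Int.fract a)
    rw [add_sub_cancel_right, abs_of_nonneg h0] at this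
    have := abs_nonneg ((k : ℝ) + Int.fract a)
    linarith
  have hp := japanese_pos (k : ℝ)
  calc japanese ((k : ℝ) + Int.fract a) ^ (-5 / 4 : ℝ) ≤ (japanese k / 2) ^ (-5 / 4 : ℝ) :=
        Real.rpow_le_rpow_of_nonpos (by positivity) h2 (by norm_num)
    _ = 2 ^ (5 / 4 : ℝ) * japanese k ^ (-5 / 4 : ℝ) := by
        rw [Real.div_rpow hp.le (by norm_num), div_eq_mul_inv, ← Real.rpow_neg (by norm_num),
          mul_comm]
        norm_num
    _ ≤ 2 ^ (2 : ℝ) * japanese k ^ (-5 / 4 : ℝ) := by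
        gcongr
        · norm_num
        · norm_num
    _ = 4 * japanese k ^ (-5 / 4 : ℝ) := by norm_num

/-- A quadratic polynomial is bounded below by the squared distance to one of two points. -/
theorem exists_sq_le_abs_quadratic {α : ℝ} (hα : α ≠ 0) (β δ : ℝ) :
    ∃ a b : ℝ, ∀ k : ℝ, |α| * (k + a) ^ 2 ≤ |α * k ^ 2 + β * k + δ| ∨
      |α| * (k + b) ^ 2 ≤ |α * k ^ 2 + β * k + δ| := by
  set m := β / (2 * α) with hm
  set d := δ / α - m ^ 2 with hd
  have e : ∀ k : ℝ, |α * k ^ 2 + β * k + δ| = |α| * |(k + m) ^ 2 + d| := by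
    intro k
    rw [← abs_mul, hd, hm]
    congr 1
    field_simp
    ring
  -- After completing the square: without distinct real roots, the vertex serves as both points;
  -- otherwise the polynomial factors and the nearer root gives the bound.
  rcases le_total 0 d with h | h
  · refine ⟨m, m, fun k => Or.inl ?_⟩
    rw [e]
    gcongr
    rw [abs_of_nonneg (by positivity)]
    linarith
  · obtain ⟨r, hr, hr2⟩ : ∃ r : ℝ, 0 ≤ r ∧ r ^ 2 = -d :=
      ⟨Real.sqrt (-d), Real.sqrt_nonneg _, Real.sq_sqrt (by linarith)⟩
    refine ⟨m - r, m + r, fun k => ?_⟩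
    rw [e]
    have e2 : (k + m) ^ 2 + d = (k + (m - r)) * (k + (m + r)) := by
      linear_combination hr2
    rw [e2, abs_mul, ← sq_abs (k + (m - r)), ← sq_abs (k + (m + r)), sq, sq]
    rcases le_total |k + (m - r)| |k + (m + r)| with h | h
    · left; gcongr
    · right; gcongr

/-- Quadratic growth doubles the exponent: 5/8 becomes 5/4 > 1, which is summable over ℤ. -/
theorem japanese_rpow_le {α : ℝ} (hα : α ≠ 0) {x y : ℝ} (h : |α| * y ^ 2 ≤ |x|) :
    japanese x ^ (-5 / 8 : ℝ)
      ≤ (min |α| 1 / 2) ^ (-5 / 8 : ℝ) * japanese y ^ (-5 / 4 : ℝ) := by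
  have hα' : 0 < |α| := abs_pos.2 hα
  have hc : 0 < min |α| 1 / 2 := by positivity
  have hy := japanese_pos y
  have h1 : min |α| 1 / 2 * japanese y ^ 2 ≤ japanese x := by
    have h2 : japanese y ^ 2 ≤ 2 * (1 + y ^ 2) := by
      simp only [japanese]
      nlinarith [sq_nonneg (1 - |y|), sq_abs y]
    calc min |α| 1 / 2 * japanese y ^ 2 ≤ min |α| 1 / 2 * (2 * (1 + y ^ 2)) := by gcongr
      _ = min |α| 1 + min |α| 1 * y ^ 2 := by ring
      _ ≤ 1 + |α| * y ^ 2 := by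
        gcongr
        · exact min_le_right _ _
        · exact min_le_left _ _
      _ ≤ japanese x := by simp only [japanese]; linarith
  calc japanese x ^ (-5 / 8 : ℝ) ≤ (min |α| 1 / 2 * japanese y ^ 2) ^ (-5 / 8 : ℝ) :=
        Real.rpow_le_rpow_of_nonpos (by positivity) h1 (by norm_num)
    _ = _ := by
        rw [Real.mul_rpow hc.le (by positivity), ← Real.rpow_natCast, ← Real.rpow_mul hy.le]
        norm_num

theorem exists_tsum_quadratic_le {α : ℝ} (hα : α ≠ 0) :
    ∃ C : ℝ≥0∞, C ≠ ∞ ∧ ∀ β δ : ℝ,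
      ∑' k : ℤ, ENNReal.ofReal (japanese (α * (k : ℝ) ^ 2 + β * k + δ) ^ (-5 / 8 : ℝ)) ≤ C := by
  set c : ℝ := (min |α| 1 / 2) ^ (-5 / 8 : ℝ) with hc
  have hc0 : 0 ≤ c := by positivity
  refine ⟨ENNReal.ofReal c * (latticeConst + latticeConst),
    ENNReal.mul_ne_top ENNReal.ofReal_ne_top (by simp [latticeConst_ne_top]), fun β δ => ?_⟩
  obtain ⟨a, b, hab⟩ := exists_sq_le_abs_quadratic hα β δ
  calc _ ≤ ∑' k : ℤ, ENNReal.ofReal c * (ENNReal.ofReal (japanese (k + a) ^ (-5 / 4 : ℝ))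
          + ENNReal.ofReal (japanese (k + b) ^ (-5 / 4 : ℝ))) := by
        refine ENNReal.tsum_le_tsum fun k => ?_
        rcases hab k with h | h
        · refine (ENNReal.ofReal_le_ofReal (japanese_rpow_le hα h)).trans ?_
          rw [ENNReal.ofReal_mul hc0]
          gcongr
          exact le_self_add
        · refine (ENNReal.ofReal_le_ofReal (japanese_rpow_le hα h)).trans ?_
          rw [ENNReal.ofReal_mul hc0]
          gcongr
          exact le_add_self
    _ ≤ _ := by
        rw [ENNReal.tsum_mul_left, ENNReal.tsum_add]
        gcongr <;> exact tsum_japanese_add_le _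

/-- The phase of γ|k|k changes its leading coefficient with the sign of k. Each term is a term of
one of two quadratic sums, so the sum of their bounds suffices. -/
theorem exists_tsum_piecewise_quadratic_le {α₁ α₂ : ℝ} (h₁ : α₁ ≠ 0) (h₂ : α₂ ≠ 0) :
    ∃ C : ℝ≥0∞, C ≠ ∞ ∧ ∀ (ψ : ℤ → ℝ) (β δ : ℝ),
      (∀ k : ℤ, ψ k = α₁ * (k : ℝ) ^ 2 + β * k + δ ∨ ψ k = α₂ * (k : ℝ) ^ 2 + β * k + δ) →
      ∑' k : ℤ, ENNReal.ofReal (japanese (ψ k) ^ (-5 / 8 : ℝ)) ≤ C := by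
  obtain ⟨C₁, hC₁, b₁⟩ := exists_tsum_quadratic_le h₁
  obtain ⟨C₂, hC₂, b₂⟩ := exists_tsum_quadratic_le h₂
  refine ⟨C₁ + C₂, ENNReal.add_ne_top.2 ⟨hC₁, hC₂⟩, fun ψ β δ hψ => ?_⟩
  refine le_trans ?_ (add_le_add (b₁ β δ) (b₂ β δ))
  rw [← ENNReal.tsum_add]
  refine ENNReal.tsum_le_tsum fun k => ?_
  rcases hψ k with h | h <;> rw [h]
  · exact le_self_add
  · exact le_add_self

/-! ### Resonance identity and multiplier bounds -/

section Resonance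

theorem abs_mul_self_eq_or (γ x : ℝ) : γ * |x| * x = γ * x ^ 2 ∨ γ * |x| * x = -γ * x ^ 2 := by
  rcases abs_choice x with h | h <;> rw [h]
  · left; ring
  · right; ring

/-- The constant 1 matters: raised to the power s − 1/2 it stays 1, which keeps the final constant
independent of s. -/
theorem japanese_add_le_mul (x y : ℝ) : japanese (x + y) ≤ japanese x * japanese y := by
  simp only [japanese]
  nlinarith [abs_add_le x y, abs_nonneg x, abs_nonneg y, mul_nonneg (abs_nonneg x) (abs_nonneg y)]

theorem japanese_neg (x : ℝ) : japanese (-x) = japanese x := by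
  simp [japanese]

/-- The reverse triangle inequality gives |2y + κx| ≥ 3c|x| − 2c|x| = c|x|. -/
theorem sq_le_abs_of_small {κ c x y : ℝ} (hκ : 3 * c ≤ |κ|) (hy : |y| ≤ c * |x|) :
    c * x ^ 2 ≤ |x * (2 * y + κ * x)| := by
  have h1 : |κ * x| ≤ |2 * y + κ * x| + 2 * |y| := by
    have h := abs_sub (2 * y + κ * x) (2 * y)
    rw [add_sub_cancel_left, abs_mul 2 y] at h
    simpa using h
  rw [abs_mul κ x] at h1
  have h2 : c * |x| ≤ |2 * y + κ * x| := by
    nlinarith [abs_nonneg x]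
  rw [abs_mul, ← sq_abs x]
  nlinarith [abs_nonneg x]

/-- The separation of the two dispersion relations. -/
def gap (γ : ℝ) : ℝ := min (min |1 - γ| |1 + γ|) 1 / 3

theorem gap_pos {γ : ℝ} (hγ : |γ| ≠ 1) : 0 < gap γ := by
  have h1 : γ ≠ 1 := fun h => hγ (by simp [h])
  have h2 : γ ≠ -1 := fun h => hγ (by simp [h])
  have h3 : 0 < |1 - γ| := abs_pos.2 (sub_ne_zero.2 h1.symm)
  have h4 : 0 < |1 + γ| := abs_pos.2 fun h => h2 (by linarith)
  unfold gap
  positivity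

theorem gap_le (γ : ℝ) : 3 * gap γ ≤ |1 - γ| ∧ 3 * gap γ ≤ |1 + γ| ∧ gap γ ≤ 1 := by
  unfold gap
  refine ⟨?_, ?_, ?_⟩
  · linarith [(min_le_left (min |1 - γ| |1 + γ|) 1).trans (min_le_left _ _)]
  · linarith [(min_le_left (min |1 - γ| |1 + γ|) 1).trans (min_le_right _ _)]
  · linarith [min_le_right (min |1 - γ| |1 + γ|) 1]

/-- If one of the Schrödinger frequencies is small compared with the Benjamin-Ono frequency, the
interaction is nonresonant. -/
theorem gap_mul_sq_le_abs_resonance {γ n₁ n₂ : ℝ}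
    (h : |n₂| ≤ gap γ * |n₁| ∨ |n₁ + n₂| ≤ gap γ * |n₁|) :
    gap γ * n₁ ^ 2 ≤ |(n₁ + n₂) ^ 2 - n₂ ^ 2 - γ * |n₁| * n₁| := by
  obtain ⟨g1, g2, -⟩ := gap_le γ
  -- For n₂ small the resonance function is n₁(2n₂ + (1 ∓ γ)n₁). For n = n₁ + n₂ small it is written
  -- as n₁(2n + (−1 ∓ γ)n₁), hence the two further coefficients.
  have g3 : 3 * gap γ ≤ |-1 - γ| := by
    rwa [← abs_neg, neg_sub, sub_neg_eq_add, add_comm]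
  have g4 : 3 * gap γ ≤ |-1 + γ| := by
    rwa [← abs_neg, neg_add, neg_neg, ← sub_eq_add_neg]
  rcases abs_mul_self_eq_or γ n₁ with e | e <;> rw [e] <;> rcases h with h | h
  · convert sq_le_abs_of_small g1 h using 2
    ring
  · convert sq_le_abs_of_small g3 h using 2
    ring
  · convert sq_le_abs_of_small g2 h using 2
    ring
  · convert sq_le_abs_of_small g4 h using 2
    ring

variable {γ n₁ n₂ σ₁ σ₂ σ : ℝ}

theorem sq_japanese_le_of_small (hγ : |γ| ≠ 1)
    (hσ : σ - σ₁ - σ₂ = (n₁ + n₂) ^ 2 - n₂ ^ 2 - γ * |n₁| * n₁)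
    (h : |n₂| ≤ gap γ * |n₁| ∨ |n₁ + n₂| ≤ gap γ * |n₁|) :
    japanese n₁ ^ 2 ≤ 4 / gap γ ^ 4 * (japanese σ + japanese σ₁ + japanese σ₂) := by
  have hc := gap_pos hγ
  have hc1 := (gap_le γ).2.2
  have h1 := gap_mul_sq_le_abs_resonance h
  rw [← hσ] at h1
  set S := japanese σ + japanese σ₁ + japanese σ₂ with hS
  have h2 : |σ - σ₁ - σ₂| ≤ S := by
    have a1 := abs_sub (σ - σ₁) σ₂
    have a2 := abs_sub σ σ₁
    simp only [hS, japanese]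
    linarith
  have hS1 : 1 ≤ S := by
    have := one_le_japanese σ
    have := japanese_pos σ₁
    have := japanese_pos σ₂
    linarith
  have h3 : japanese n₁ ^ 2 ≤ 2 * (1 + n₁ ^ 2) := by
    simp only [japanese]
    nlinarith [sq_nonneg (1 - |n₁|), sq_abs n₁]
  have h4 : gap γ * japanese n₁ ^ 2 ≤ 4 * S := by nlinarith
  -- A single factor of the gap would do here. The fourth power makes the constant the same in all
  -- cases; `pow_four_japanese_le` requires it.
  have h5 : gap γ ^ 4 ≤ gap γ := by
    simpa using pow_le_pow_of_le_one hc.le hc1 (show 1 ≤ 4 by norm_num)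
  rw [div_mul_eq_mul_div, le_div_iff₀ (by positivity)]
  nlinarith [sq_nonneg (japanese n₁)]

theorem one_le_modulations (a b c : ℝ) : 1 ≤ japanese a + japanese b + japanese c := by
  have := one_le_japanese a
  have := japanese_pos b
  have := japanese_pos c
  linarith

theorem japanese_le_div_of_large (hγ : |γ| ≠ 1) {m n : ℝ} (h : gap γ * |m| ≤ |n|) :
    japanese m ≤ japanese n / gap γ := by
  have hc := gap_pos hγ
  have hc1 := (gap_le γ).2.2
  rw [le_div_iff₀ hc]
  simp only [japanese]
  nlinarith

/-- If n₂ is small compared with n₁, the modulations control ⟨n₁⟩² and ⟨n⟩ ≤ ⟨n₁⟩⟨n₂⟩. Otherwise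
⟨n₁⟩, and hence ⟨n⟩, is controlled by ⟨n₂⟩ alone. -/
theorem sq_japanese_add_le (hγ : |γ| ≠ 1)
    (hσ : σ - σ₁ - σ₂ = (n₁ + n₂) ^ 2 - n₂ ^ 2 - γ * |n₁| * n₁) :
    japanese (n₁ + n₂) ^ 2
      ≤ 4 / gap γ ^ 4 * japanese n₂ ^ 2 * (japanese σ + japanese σ₁ + japanese σ₂) := by
  have hc := gap_pos hγ
  have hc1 := (gap_le γ).2.2
  have hn := japanese_pos (n₁ + n₂)
  have hn1 := japanese_pos n₁
  have hn2 := japanese_pos n₂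
  have hS1 := one_le_modulations σ σ₁ σ₂
  rcases le_total |n₂| (gap γ * |n₁|) with h | h
  · have h1 := sq_japanese_le_of_small hγ hσ (Or.inl h)
    calc japanese (n₁ + n₂) ^ 2 ≤ (japanese n₁ * japanese n₂) ^ 2 := by
          gcongr
          exact japanese_add_le_mul _ _
      _ = japanese n₁ ^ 2 * japanese n₂ ^ 2 := by ring
      _ ≤ (4 / gap γ ^ 4 * (japanese σ + japanese σ₁ + japanese σ₂)) * japanese n₂ ^ 2 := by
          gcongr
      _ = _ := by ring
  · have h1 := japanese_le_div_of_large hγ h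
    have h2 : japanese (n₁ + n₂) ≤ 2 / gap γ * japanese n₂ := by
      have h3 : japanese (n₁ + n₂) ≤ japanese n₁ + japanese n₂ := by
        simp only [japanese]
        linarith [abs_add_le n₁ n₂]
      have h4 : japanese n₂ ≤ japanese n₂ / gap γ := le_div_self hn2.le hc hc1
      calc _ ≤ japanese n₂ / gap γ + japanese n₂ / gap γ := by linarith
        _ = _ := by ring
    have h5 : gap γ ^ 4 ≤ gap γ ^ 2 := pow_le_pow_of_le_one hc.le hc1 (by norm_num)
    calc japanese (n₁ + n₂) ^ 2 ≤ (2 / gap γ * japanese n₂) ^ 2 := by gcongr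
      _ = 4 / gap γ ^ 2 * japanese n₂ ^ 2 * 1 := by ring
      _ ≤ _ := by gcongr

/-- In the nonresonant case one factor ⟨n₁⟩² is paid by the modulations and the other by ⟨n₁⟩ ≤
⟨n⟩⟨n₂⟩. Otherwise ⟨n⟩ and ⟨n₂⟩ each dominate a multiple of ⟨n₁⟩ and pay for two powers. -/
theorem pow_four_japanese_le (hγ : |γ| ≠ 1)
    (hσ : σ - σ₁ - σ₂ = (n₁ + n₂) ^ 2 - n₂ ^ 2 - γ * |n₁| * n₁) :
    japanese n₁ ^ 4 ≤ 4 / gap γ ^ 4 * (japanese (n₁ + n₂) ^ 2 * japanese n₂ ^ 2)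
      * (japanese σ + japanese σ₁ + japanese σ₂) := by
  have hc := gap_pos hγ
  have hn := japanese_pos (n₁ + n₂)
  have hn1 := japanese_pos n₁
  have hn2 := japanese_pos n₂
  have hS1 := one_le_modulations σ σ₁ σ₂
  by_cases h : |n₂| ≤ gap γ * |n₁| ∨ |n₁ + n₂| ≤ gap γ * |n₁|
  · have h1 := sq_japanese_le_of_small hγ hσ h
    have h2 : japanese n₁ ≤ japanese (n₁ + n₂) * japanese n₂ := by
      have := japanese_add_le_mul (n₁ + n₂) (-n₂)
      rwa [add_neg_cancel_right, japanese_neg] at this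
    calc japanese n₁ ^ 4 = japanese n₁ ^ 2 * japanese n₁ ^ 2 := by ring
      _ ≤ (japanese (n₁ + n₂) * japanese n₂) ^ 2
          * (4 / gap γ ^ 4 * (japanese σ + japanese σ₁ + japanese σ₂)) := by gcongr
      _ = _ := by ring
  · push Not at h
    have h1 := japanese_le_div_of_large hγ h.1.le
    have h2 := japanese_le_div_of_large hγ h.2.le
    calc japanese n₁ ^ 4 = japanese n₁ ^ 2 * japanese n₁ ^ 2 := by ring
      _ ≤ (japanese (n₁ + n₂) / gap γ) ^ 2 * (japanese n₂ / gap γ) ^ 2 := by gcongr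
      _ = 1 / gap γ ^ 4 * (japanese (n₁ + n₂) ^ 2 * japanese n₂ ^ 2) * 1 := by
          field_simp
      _ ≤ _ := by
          gcongr
          norm_num

theorem rpow_quarter_add_le {a b c : ℝ} (ha : 0 ≤ a) (hb : 0 ≤ b) (hc : 0 ≤ c) :
    (a + b + c) ^ (1 / 4 : ℝ) ≤ a ^ (1 / 4 : ℝ) + b ^ (1 / 4 : ℝ) + c ^ (1 / 4 : ℝ) :=
  (Real.rpow_add_le_add_rpow (by positivity) hc (by norm_num) (by norm_num)).trans
    (by gcongr; exact Real.rpow_add_le_add_rpow ha hb (by norm_num) (by norm_num))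

theorem pow_rpow_quarter {a : ℝ} (ha : 0 ≤ a) : (a ^ 4) ^ (1 / 4 : ℝ) = a ∧
    (a ^ 2) ^ (1 / 4 : ℝ) = a ^ (1 / 2 : ℝ) := by
  constructor
  · rw [← Real.rpow_natCast, ← Real.rpow_mul ha]; norm_num
  · rw [← Real.rpow_natCast, ← Real.rpow_mul ha]; norm_num

/-- The constant in the frequency bounds. -/
def resConst (γ : ℝ) : ℝ := (4 / gap γ ^ 4) ^ (1 / 4 : ℝ)

theorem resConst_nonneg (γ : ℝ) : 0 ≤ resConst γ := by
  unfold resConst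
  positivity

theorem japanese_add_rpow_half_le (hγ : |γ| ≠ 1)
    (hσ : σ - σ₁ - σ₂ = (n₁ + n₂) ^ 2 - n₂ ^ 2 - γ * |n₁| * n₁) :
    japanese (n₁ + n₂) ^ (1 / 2 : ℝ) ≤ resConst γ * japanese n₂ ^ (1 / 2 : ℝ)
      * (japanese σ ^ (1 / 4 : ℝ) + japanese σ₁ ^ (1 / 4 : ℝ) + japanese σ₂ ^ (1 / 4 : ℝ)) := by
  have hn2 := japanese_pos n₂
  have h := Real.rpow_le_rpow (by positivity) (sq_japanese_add_le hγ hσ)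
    (by norm_num : (0 : ℝ) ≤ 1 / 4)
  have hS := one_le_modulations σ σ₁ σ₂
  rw [(pow_rpow_quarter (japanese_pos _).le).2, Real.mul_rpow (by positivity) (by linarith),
    Real.mul_rpow (by positivity) (by positivity), (pow_rpow_quarter hn2.le).2] at h
  refine h.trans ?_
  rw [resConst]
  gcongr
  exact rpow_quarter_add_le (japanese_pos _).le (japanese_pos _).le (japanese_pos _).le

theorem japanese_le_rpow_half_mul (hγ : |γ| ≠ 1)
    (hσ : σ - σ₁ - σ₂ = (n₁ + n₂) ^ 2 - n₂ ^ 2 - γ * |n₁| * n₁) :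
    japanese n₁ ≤ resConst γ * (japanese (n₁ + n₂) ^ (1 / 2 : ℝ) * japanese n₂ ^ (1 / 2 : ℝ))
      * (japanese σ ^ (1 / 4 : ℝ) + japanese σ₁ ^ (1 / 4 : ℝ) + japanese σ₂ ^ (1 / 4 : ℝ)) := by
  have hn := japanese_pos (n₁ + n₂)
  have hn1 := japanese_pos n₁
  have hn2 := japanese_pos n₂
  have h := Real.rpow_le_rpow (by positivity) (pow_four_japanese_le hγ hσ)
    (by norm_num : (0 : ℝ) ≤ 1 / 4)
  have hS := one_le_modulations σ σ₁ σ₂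
  rw [(pow_rpow_quarter hn1.le).1, Real.mul_rpow (by positivity) (by linarith),
    Real.mul_rpow (by positivity) (by positivity), Real.mul_rpow (by positivity) (by positivity),
    (pow_rpow_quarter hn.le).2, (pow_rpow_quarter hn2.le).2] at h
  refine h.trans ?_
  rw [resConst]
  gcongr
  exact rpow_quarter_add_le (japanese_pos _).le (japanese_pos _).le (japanese_pos _).le

/-- `A` is the output modulation, `B` and `E` the input ones. The function whose modulation supplies
the quarter power gives up its weight and the other two keep theirs. This is affordable because 1/4
≤ 7/16 for `A` and 1/4 ≤ 1/2 for `B` and `E`. -/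
theorem weights_le {A B E : ℝ} (hA : 1 ≤ A) (hB : 1 ≤ B) (hE : 1 ≤ E) :
    A ^ (-7 / 16 : ℝ) * (A ^ (1 / 4 : ℝ) + B ^ (1 / 4 : ℝ) + E ^ (1 / 4 : ℝ))
      ≤ B ^ (1 / 2 : ℝ) * E ^ (1 / 2 : ℝ) * (B ^ (-7 / 16 : ℝ) * E ^ (-7 / 16 : ℝ)
        + B ^ (-7 / 16 : ℝ) * A ^ (-7 / 16 : ℝ) + E ^ (-7 / 16 : ℝ) * A ^ (-7 / 16 : ℝ)) := by
  have pA : 0 < A := by linarith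
  have pB : 0 < B := by linarith
  have pE : 0 < E := by linarith
  have eA : A ^ (-7 / 16 : ℝ) * A ^ (1 / 4 : ℝ) = A ^ (-3 / 16 : ℝ) := by
    rw [← Real.rpow_add pA]; norm_num
  have eB : B ^ (1 / 2 : ℝ) * B ^ (-7 / 16 : ℝ) = B ^ (1 / 16 : ℝ) := by
    rw [← Real.rpow_add pB]; norm_num
  have eE : E ^ (1 / 2 : ℝ) * E ^ (-7 / 16 : ℝ) = E ^ (1 / 16 : ℝ) := by
    rw [← Real.rpow_add pE]; norm_num
  have t1 : A ^ (-3 / 16 : ℝ) ≤ B ^ (1 / 16 : ℝ) * E ^ (1 / 16 : ℝ) :=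
    (Real.rpow_le_one_of_one_le_of_nonpos hA (by norm_num)).trans
      (one_le_mul_of_one_le_of_one_le (Real.one_le_rpow hB (by norm_num))
        (Real.one_le_rpow hE (by norm_num)))
  have t2 : B ^ (1 / 4 : ℝ) ≤ B ^ (1 / 2 : ℝ) * E ^ (1 / 16 : ℝ) :=
    (Real.rpow_le_rpow_of_exponent_le hB (by norm_num)).trans
      (le_mul_of_one_le_right (by positivity) (Real.one_le_rpow hE (by norm_num)))
  have t3 : E ^ (1 / 4 : ℝ) ≤ B ^ (1 / 16 : ℝ) * E ^ (1 / 2 : ℝ) :=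
    (Real.rpow_le_rpow_of_exponent_le hE (by norm_num)).trans
      (le_mul_of_one_le_left (by positivity) (Real.one_le_rpow hB (by norm_num)))
  calc A ^ (-7 / 16 : ℝ) * (A ^ (1 / 4 : ℝ) + B ^ (1 / 4 : ℝ) + E ^ (1 / 4 : ℝ))
      = A ^ (-3 / 16 : ℝ) + A ^ (-7 / 16 : ℝ) * B ^ (1 / 4 : ℝ)
        + A ^ (-7 / 16 : ℝ) * E ^ (1 / 4 : ℝ) := by rw [← eA]; ring
    _ ≤ B ^ (1 / 16 : ℝ) * E ^ (1 / 16 : ℝ)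
        + A ^ (-7 / 16 : ℝ) * (B ^ (1 / 2 : ℝ) * E ^ (1 / 16 : ℝ))
        + A ^ (-7 / 16 : ℝ) * (B ^ (1 / 16 : ℝ) * E ^ (1 / 2 : ℝ)) := by gcongr
    _ = _ := by rw [← eB, ← eE]; ring

/-- The multiplier bound for the Schrödinger-valued estimate. -/
theorem multiplier_schrodinger_le {s : ℝ} (hs : 1 / 2 ≤ s) (hγ : |γ| ≠ 1)
    (hσ : σ - σ₁ - σ₂ = (n₁ + n₂) ^ 2 - n₂ ^ 2 - γ * |n₁| * n₁) :
    japanese (n₁ + n₂) ^ s * japanese σ ^ (-7 / 16 : ℝ)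
      ≤ resConst γ * ((japanese n₁ ^ (s - 1 / 2) * japanese σ₁ ^ (1 / 2 : ℝ))
          * (japanese n₂ ^ s * japanese σ₂ ^ (1 / 2 : ℝ))
        * (japanese σ₁ ^ (-7 / 16 : ℝ) * japanese σ₂ ^ (-7 / 16 : ℝ)
          + japanese σ₁ ^ (-7 / 16 : ℝ) * japanese σ ^ (-7 / 16 : ℝ)
          + japanese σ₂ ^ (-7 / 16 : ℝ) * japanese σ ^ (-7 / 16 : ℝ))) := by
  have hn := japanese_pos (n₁ + n₂)
  have hn1 := japanese_pos n₁
  have hn2 := japanese_pos n₂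
  have pσ := japanese_pos σ
  have pσ₁ := japanese_pos σ₁
  have pσ₂ := japanese_pos σ₂
  have hR := resConst_nonneg γ
  have e1 : japanese (n₁ + n₂) ^ s
      = japanese (n₁ + n₂) ^ (s - 1 / 2) * japanese (n₁ + n₂) ^ (1 / 2 : ℝ) := by
    rw [← Real.rpow_add hn]; ring_nf
  have e2 : japanese n₂ ^ s = japanese n₂ ^ (s - 1 / 2) * japanese n₂ ^ (1 / 2 : ℝ) := by
    rw [← Real.rpow_add hn2]; ring_nf
  have h1 : japanese (n₁ + n₂) ^ (s - 1 / 2)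
      ≤ japanese n₁ ^ (s - 1 / 2) * japanese n₂ ^ (s - 1 / 2) := by
    rw [← Real.mul_rpow hn1.le hn2.le]
    exact Real.rpow_le_rpow hn.le (japanese_add_le_mul _ _) (by linarith)
  have h2 := japanese_add_rpow_half_le hγ hσ
  have h3 := weights_le (one_le_japanese σ) (one_le_japanese σ₁) (one_le_japanese σ₂)
  rw [e1, e2]
  calc _ ≤ (japanese n₁ ^ (s - 1 / 2) * japanese n₂ ^ (s - 1 / 2))
        * (resConst γ * japanese n₂ ^ (1 / 2 : ℝ)
          * (japanese σ ^ (1 / 4 : ℝ) + japanese σ₁ ^ (1 / 4 : ℝ) + japanese σ₂ ^ (1 / 4 : ℝ)))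
        * japanese σ ^ (-7 / 16 : ℝ) := by gcongr
    _ = resConst γ * (japanese n₁ ^ (s - 1 / 2) * japanese n₂ ^ (s - 1 / 2)
        * japanese n₂ ^ (1 / 2 : ℝ)) * (japanese σ ^ (-7 / 16 : ℝ) *
        (japanese σ ^ (1 / 4 : ℝ) + japanese σ₁ ^ (1 / 4 : ℝ) + japanese σ₂ ^ (1 / 4 : ℝ))) := by
        ring
    _ ≤ _ := mul_le_mul_of_nonneg_left h3 (by positivity)
    _ = _ := by ring

/-- The multiplier bound for the Benjamin-Ono-valued estimate. -/
theorem multiplier_benjaminOno_le {s : ℝ} (hs : 1 / 2 ≤ s) (hγ : |γ| ≠ 1)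
    (hσ : σ - σ₁ - σ₂ = (n₁ + n₂) ^ 2 - n₂ ^ 2 - γ * |n₁| * n₁) :
    japanese n₁ * japanese n₁ ^ (s - 1 / 2) * japanese σ₁ ^ (-7 / 16 : ℝ)
      ≤ resConst γ * ((japanese n₂ ^ s * japanese σ₂ ^ (1 / 2 : ℝ))
          * (japanese (n₁ + n₂) ^ s * japanese σ ^ (1 / 2 : ℝ))
        * (japanese σ₁ ^ (-7 / 16 : ℝ) * japanese σ₂ ^ (-7 / 16 : ℝ)
          + japanese σ₁ ^ (-7 / 16 : ℝ) * japanese σ ^ (-7 / 16 : ℝ)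
          + japanese σ₂ ^ (-7 / 16 : ℝ) * japanese σ ^ (-7 / 16 : ℝ))) := by
  have hn := japanese_pos (n₁ + n₂)
  have hn1 := japanese_pos n₁
  have hn2 := japanese_pos n₂
  have pσ := japanese_pos σ
  have pσ₁ := japanese_pos σ₁
  have pσ₂ := japanese_pos σ₂
  have hR := resConst_nonneg γ
  have e1 : japanese (n₁ + n₂) ^ s
      = japanese (n₁ + n₂) ^ (s - 1 / 2) * japanese (n₁ + n₂) ^ (1 / 2 : ℝ) := by
    rw [← Real.rpow_add hn]; ring_nf
  have e2 : japanese n₂ ^ s = japanese n₂ ^ (s - 1 / 2) * japanese n₂ ^ (1 / 2 : ℝ) := by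
    rw [← Real.rpow_add hn2]; ring_nf
  have h1 : japanese n₁ ^ (s - 1 / 2)
      ≤ japanese (n₁ + n₂) ^ (s - 1 / 2) * japanese n₂ ^ (s - 1 / 2) := by
    rw [← Real.mul_rpow hn.le hn2.le]
    refine Real.rpow_le_rpow hn1.le ?_ (by linarith)
    have := japanese_add_le_mul (n₁ + n₂) (-n₂)
    rwa [add_neg_cancel_right, japanese_neg] at this
  have h2 := japanese_le_rpow_half_mul hγ hσ
  have h3 := weights_le (one_le_japanese σ₁) (one_le_japanese σ₂) (one_le_japanese σ)
  rw [e1, e2]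
  calc _ ≤ (resConst γ * (japanese (n₁ + n₂) ^ (1 / 2 : ℝ) * japanese n₂ ^ (1 / 2 : ℝ))
          * (japanese σ ^ (1 / 4 : ℝ) + japanese σ₁ ^ (1 / 4 : ℝ) + japanese σ₂ ^ (1 / 4 : ℝ)))
        * (japanese (n₁ + n₂) ^ (s - 1 / 2) * japanese n₂ ^ (s - 1 / 2))
        * japanese σ₁ ^ (-7 / 16 : ℝ) := by gcongr
    _ = resConst γ * (japanese (n₁ + n₂) ^ (1 / 2 : ℝ) * japanese n₂ ^ (1 / 2 : ℝ)
        * (japanese (n₁ + n₂) ^ (s - 1 / 2) * japanese n₂ ^ (s - 1 / 2)))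
        * (japanese σ₁ ^ (-7 / 16 : ℝ) *
        (japanese σ₁ ^ (1 / 4 : ℝ) + japanese σ₂ ^ (1 / 4 : ℝ) + japanese σ ^ (1 / 4 : ℝ))) := by
        ring
    _ ≤ _ := mul_le_mul_of_nonneg_left h3 (by positivity)
    _ = _ := by ring

end Resonance

/-! ### Kernel bounds and weighted norms on ℤ × ℝ -/

section Spectral

/-- The measure on the frequency space `ℤ × ℝ`. -/
abbrev freqMeasure : Measure (ℤ × ℝ) := (Measure.count : Measure ℤ).prod volume

theorem lintegral_freqMeasure {f : ℤ × ℝ → ℝ≥0∞} (hf : Measurable f) :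
    ∫⁻ z, f z ∂freqMeasure = ∑' n : ℤ, ∫⁻ τ, f (n, τ) := by
  rw [lintegral_prod _ hf.aemeasurable, lintegral_count]

theorem measurable_of_forall_int {β : Type*} [MeasurableSpace β] {f : ℤ × ℝ → β}
    (h : ∀ n, Measurable fun τ => f (n, τ)) : Measurable f :=
  measurable_from_prod_countable_right h

/-- The weight `⟨τ + disp(n)⟩^(-7/16)`. -/
def modWeight (disp : ℤ → ℝ) (z : ℤ × ℝ) : ℝ≥0∞ :=
  ENNReal.ofReal (japanese (z.2 + disp z.1) ^ (-7 / 16 : ℝ))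

theorem measurable_modWeight (disp : ℤ → ℝ) : Measurable (modWeight disp) :=
  measurable_of_forall_int fun n =>
    ((measurable_japanese.comp (measurable_add_const (disp n))).pow_const _).ennreal_ofReal

theorem modWeight_sq (disp : ℤ → ℝ) (z : ℤ × ℝ) :
    modWeight disp z ^ 2 = ENNReal.ofReal (japanese (z.2 + disp z.1) ^ (-7 / 8 : ℝ)) := by
  have h := japanese_pos (z.2 + disp z.1)
  rw [modWeight, ← ENNReal.ofReal_pow (by positivity), ← Real.rpow_natCast, ← Real.rpow_mul h.le]
  norm_num

/-- For each k the integral in τ is a product of two translated weights. The difference of the two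
shifts is the phase d₁(k) + d₂(n − k) + τ. -/
theorem conv_modWeight_le (d₁ d₂ : ℤ → ℝ) (z : ℤ × ℝ) :
    conv freqMeasure (modWeight d₁ ^ 2) (modWeight d₂ ^ 2) z ≤ weightConst *
      ∑' k : ℤ, ENNReal.ofReal (japanese (d₁ k + d₂ (z.1 - k) + z.2) ^ (-5 / 8 : ℝ)) := by
  have hm : Measurable fun x => (modWeight d₁ ^ 2) x * (modWeight d₂ ^ 2) (z - x) :=
    ((measurable_modWeight d₁).pow_const 2).mul
      (((measurable_modWeight d₂).pow_const 2).comp (measurable_const.sub measurable_id))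
  rw [conv, lintegral_freqMeasure hm, ← ENNReal.tsum_mul_left]
  refine ENNReal.tsum_le_tsum fun k => ?_
  have h := lintegral_weight_mul_le (d₁ k) (-(z.2 + d₂ (z.1 - k)))
  rw [show d₁ k - -(z.2 + d₂ (z.1 - k)) = d₁ k + d₂ (z.1 - k) + z.2 by ring] at h
  refine le_trans (le_of_eq (lintegral_congr fun τ => ?_)) h
  simp only [Pi.pow_apply, modWeight_sq, Prod.fst_sub, Prod.snd_sub]
  rw [← japanese_neg (z.2 - τ + d₂ (z.1 - k))]
  ring_nf

theorem corr_modWeight_le (d₁ d₂ : ℤ → ℝ) (z : ℤ × ℝ) :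
    corr freqMeasure (modWeight d₁ ^ 2) (modWeight d₂ ^ 2) z ≤ weightConst *
      ∑' k : ℤ, ENNReal.ofReal (japanese (d₁ k - d₂ (k + z.1) - z.2) ^ (-5 / 8 : ℝ)) := by
  have hm : Measurable fun x => (modWeight d₁ ^ 2) x * (modWeight d₂ ^ 2) (x + z) :=
    ((measurable_modWeight d₁).pow_const 2).mul
      (((measurable_modWeight d₂).pow_const 2).comp (measurable_id.add measurable_const))
  rw [corr, lintegral_freqMeasure hm, ← ENNReal.tsum_mul_left]
  refine ENNReal.tsum_le_tsum fun k => ?_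
  have h := lintegral_weight_mul_le (d₁ k) (z.2 + d₂ (k + z.1))
  rw [show d₁ k - (z.2 + d₂ (k + z.1)) = d₁ k - d₂ (k + z.1) - z.2 by ring] at h
  refine le_trans (le_of_eq (lintegral_congr fun τ => ?_)) h
  simp only [Pi.pow_apply, modWeight_sq, Prod.fst_add, Prod.snd_add, add_assoc]

/-- The Schrödinger dispersion relation. -/
abbrev dispX : ℤ → ℝ := fun n => (n : ℝ) ^ 2

/-- The Benjamin-Ono dispersion relation. -/
abbrev dispY (γ : ℝ) : ℤ → ℝ := fun n => γ * |(n : ℝ)| * n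

/-- The leading coefficients of the phases in k are 1 ± γ, −1 ± γ and 2 respectively, nonzero since
|γ| ≠ 1. The output point (n, τ) enters only the lower-order coefficients, in which the lattice sums
are uniform. -/
theorem exists_kernel_bound {γ : ℝ} (hγ : |γ| ≠ 1) : ∃ C : ℝ≥0∞, C ≠ ∞ ∧
    (∀ z, conv freqMeasure (modWeight (dispY γ) ^ 2) (modWeight dispX ^ 2) z ≤ C) ∧
    (∀ z, corr freqMeasure (modWeight (dispY γ) ^ 2) (modWeight dispX ^ 2) z ≤ C) ∧
    (∀ z, conv freqMeasure (modWeight dispX ^ 2) (modWeight dispX ^ 2) z ≤ C) := by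
  have h1 : 1 - γ ≠ 0 := fun h => hγ (by simp [← sub_eq_zero.1 h])
  have h2 : 1 + γ ≠ 0 := fun h => hγ (by simp [show γ = -1 by linarith])
  obtain ⟨C₁, f₁, b₁⟩ := exists_tsum_piecewise_quadratic_le h2 h1
  obtain ⟨C₂, f₂, b₂⟩ := exists_tsum_piecewise_quadratic_le (α₁ := -1 + γ) (α₂ := -1 - γ)
    (fun h => h1 (by linarith)) (fun h => h2 (by linarith))
  obtain ⟨C₃, f₃, b₃⟩ := exists_tsum_quadratic_le (two_ne_zero (α := ℝ))
  refine ⟨weightConst * (C₁ + C₂ + C₃), ENNReal.mul_ne_top weightConst_ne_top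
    (by simp [f₁, f₂, f₃]), fun z => ?_, fun z => ?_, fun z => ?_⟩
  · refine (conv_modWeight_le _ _ z).trans ?_
    gcongr
    refine (b₁ _ (-2 * z.1) (z.1 ^ 2 + z.2) fun k => ?_).trans
      (le_self_add.trans le_self_add)
    rcases abs_mul_self_eq_or γ k with e | e
    · left; simp only [dispX, dispY]; rw [e]; push_cast; ring
    · right; simp only [dispX, dispY]; rw [e]; push_cast; ring
  · refine (corr_modWeight_le _ _ z).trans ?_
    gcongr
    refine (b₂ _ (-2 * z.1) (-z.1 ^ 2 - z.2) fun k => ?_).trans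
      (le_add_self.trans le_self_add)
    rcases abs_mul_self_eq_or γ k with e | e
    · left; simp only [dispX, dispY]; rw [e]; push_cast; ring
    · right; simp only [dispX, dispY]; rw [e]; push_cast; ring
  · refine (conv_modWeight_le _ _ z).trans ?_
    gcongr
    refine le_trans (le_of_eq (tsum_congr fun k => ?_))
      ((b₃ (-2 * z.1) (z.1 ^ 2 + z.2)).trans le_add_self)
    congr 3
    simp only [dispX]
    push_cast
    ring

/-- The weighted absolute value of a function on frequency space. -/
def weighted (disp : ℤ → ℝ) (s b : ℝ) (F : ℤ → ℝ → ℂ) (z : ℤ × ℝ) : ℝ≥0∞ :=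
  ENNReal.ofReal (japanese z.1 ^ s * japanese (z.2 + disp z.1) ^ b) * ‖F z.1 z.2‖ₑ

theorem measurable_weighted (disp : ℤ → ℝ) (s b : ℝ) {F : ℤ → ℝ → ℂ}
    (hF : ∀ n, Measurable (F n)) : Measurable (weighted disp s b F) :=
  measurable_of_forall_int fun n => by
    have h : Measurable fun τ : ℝ => japanese (n : ℝ) ^ s * japanese (τ + disp n) ^ b :=
      ((measurable_japanese.comp (measurable_add_const (disp n))).pow_const _).const_mul _
    exact h.ennreal_ofReal.mul (hF n).enorm

theorem weighted_sq (disp : ℤ → ℝ) (s b : ℝ) (F : ℤ → ℝ → ℂ) (n : ℤ) (τ : ℝ) :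
    weighted disp s b F (n, τ) ^ 2 = ENNReal.ofReal
      (japanese (τ + disp n) ^ (2 * b) * japanese (n : ℝ) ^ (2 * s) * ‖F n τ‖ ^ 2) := by
  have h1 := japanese_pos (τ + disp n)
  have h2 := japanese_pos (n : ℝ)
  rw [weighted, ← ofReal_norm, ← ENNReal.ofReal_mul (by positivity),
    ← ENNReal.ofReal_pow (by positivity)]
  congr 1
  rw [mul_comm 2 b, mul_comm 2 s, Real.rpow_mul h1.le, Real.rpow_mul h2.le, Real.rpow_two,
    Real.rpow_two]
  ring

theorem weightedNorm_eq (disp : ℤ → ℝ) (s b : ℝ) {F : ℤ → ℝ → ℂ} (hF : ∀ n, Measurable (F n)) :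
    weightedNorm disp s b F = (∫⁻ z, weighted disp s b F z ^ 2 ∂freqMeasure) ^ (1 / 2 : ℝ) := by
  rw [lintegral_freqMeasure ((measurable_weighted disp s b hF).pow_const 2)]
  simp only [weighted_sq, weightedNorm]

theorem weightedNorm_le (disp : ℤ → ℝ) (s b : ℝ) {F : ℤ → ℝ → ℂ} {k : ℤ × ℝ → ℝ≥0∞}
    (hk : Measurable k) (h : ∀ z, weighted disp s b F z ≤ k z) :
    weightedNorm disp s b F ≤ (∫⁻ z, k z ^ 2 ∂freqMeasure) ^ (1 / 2 : ℝ) := by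
  rw [lintegral_freqMeasure (hk.pow_const 2), weightedNorm]
  refine ENNReal.rpow_le_rpow (ENNReal.tsum_le_tsum fun n => lintegral_mono fun τ => ?_)
    (by norm_num)
  rw [← weighted_sq]
  exact pow_le_pow_left' (h (n, τ)) 2

/-- Testing against Schwartz functions forces each `F n` to be a.e. strongly measurable; changing it
on a null set affects neither the pairings nor the norms. -/
theorem HasFourierTransform.exists_measurable {L : ℝ} {T : Functional L} {F : ℤ → ℝ → ℂ}
    (h : HasFourierTransform T F) : ∃ F' : ℤ → ℝ → ℂ, (∀ n, Measurable (F' n)) ∧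
      HasFourierTransform T F' ∧
      ∀ disp s b, weightedNorm disp s b F' = weightedNorm disp s b F := by
  have hpi : (2 * Real.pi) ≠ 0 := Real.two_pi_pos.ne'
  have hm : ∀ n, AEStronglyMeasurable fun ξ => F n (2 * Real.pi * ξ) := fun n =>
    (locallyIntegrable_of_forall_schwartz fun χ => (h n χ).1).aestronglyMeasurable
  have hq : Measure.QuasiMeasurePreserving (fun τ : ℝ => (2 * Real.pi)⁻¹ * τ) :=
    Measure.quasiMeasurePreserving_smul volume (inv_ne_zero hpi)
  have hm' : ∀ n, AEStronglyMeasurable (F n) := fun n => by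
    refine ((hm n).comp_quasiMeasurePreserving hq).congr (Filter.Eventually.of_forall fun τ => ?_)
    simp only [Function.comp]
    rw [mul_inv_cancel_left₀ hpi]
  refine ⟨fun n => (hm' n).mk, fun n => (hm' n).stronglyMeasurable_mk.measurable,
    fun n χ => ?_, fun disp s b => ?_⟩
  · have hq' : Measure.QuasiMeasurePreserving (fun τ : ℝ => (2 * Real.pi) * τ) :=
      Measure.quasiMeasurePreserving_smul volume hpi
    have e : (fun ξ : ℝ => F n (2 * Real.pi * ξ) * χ ξ)
        =ᵐ[volume] fun ξ : ℝ => (hm' n).mk (F n) (2 * Real.pi * ξ) * χ ξ := by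
      filter_upwards [hq'.ae_eq_comp (hm' n).ae_eq_mk] with ξ hξ
      simp only [Function.comp] at hξ
      rw [hξ]
    exact ⟨(h n χ).1.congr e, (integral_congr_ae e).symm.trans (h n χ).2⟩
  · simp only [weightedNorm]
    congr 1
    refine tsum_congr fun n => lintegral_congr_ae ?_
    filter_upwards [(hm' n).ae_eq_mk] with τ hτ
    rw [hτ]

end Spectral

/-! ### From representatives of the transforms to the norms -/

/-- Indices with `f i = ∞` are handled by comparison with a finite one. This lets two infima be
taken in turn, the prefactor being finite each time and the convention 0 · ∞ = 0 doing no harm. -/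
theorem le_mul_iInf_of_forall_lt_top {ι : Sort*} {f : ι → ℝ≥0∞} {a X : ℝ≥0∞} (ha : a ≠ ∞)
    (hf : ⨅ i, f i < ∞) (h : ∀ i, f i < ∞ → X ≤ a * f i) : X ≤ a * ⨅ i, f i := by
  obtain ⟨i₀, hi₀⟩ := iInf_lt_iff.1 hf
  rw [ENNReal.mul_iInf' (fun h => absurd h ha) fun _ => ⟨i₀⟩]
  refine le_iInf fun i => ?_
  rcases lt_or_ge (f i) ∞ with hi | hi
  · exact h i hi
  · exact (h i₀ hi₀).trans (mul_le_mul' le_rfl (le_top.trans hi))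

/-- To bound a bilinear expression by the norms of two distributions, it suffices to bound it by
the weighted norms of measurable representatives of their Fourier transforms. -/
theorem le_mul_bourgainNorm {L₁ L₂ : ℝ} {T₁ : Functional L₁} {T₂ : Functional L₂}
    {d₁ d₂ : ℤ → ℝ} {s₁ s₂ b₁ b₂ : ℝ} {C X : ℝ≥0∞} (hC : C ≠ ∞)
    (h₁ : bourgainNorm d₁ s₁ b₁ T₁ < ∞) (h₂ : bourgainNorm d₂ s₂ b₂ T₂ < ∞)
    (h : ∀ F G : ℤ → ℝ → ℂ, HasFourierTransform T₁ F → HasFourierTransform T₂ G →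
      (∀ n, Measurable (F n)) → (∀ n, Measurable (G n)) →
      X ≤ C * weightedNorm d₁ s₁ b₁ F * weightedNorm d₂ s₂ b₂ G) :
    X ≤ C * bourgainNorm d₁ s₁ b₁ T₁ * bourgainNorm d₂ s₂ b₂ T₂ := by
  have h' : ∀ F G : ℤ → ℝ → ℂ, HasFourierTransform T₁ F → HasFourierTransform T₂ G →
      X ≤ C * weightedNorm d₁ s₁ b₁ F * weightedNorm d₂ s₂ b₂ G := by
    intro F G hF hG
    obtain ⟨F', mF, hF', eF⟩ := hF.exists_measurable
    obtain ⟨G', mG, hG', eG⟩ := hG.exists_measurable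
    rw [← eF, ← eG]
    exact h F' G' hF' hG' mF mG
  have e₂ : ∀ F, HasFourierTransform T₁ F → weightedNorm d₁ s₁ b₁ F < ∞ →
      X ≤ C * weightedNorm d₁ s₁ b₁ F * bourgainNorm d₂ s₂ b₂ T₂ := by
    intro F hF hlt
    rw [bourgainNorm, iInf_subtype'] at h₂ ⊢
    exact le_mul_iInf_of_forall_lt_top (ENNReal.mul_ne_top hC hlt.ne) h₂
      fun G _ => h' F G hF G.2
  rw [mul_right_comm]
  have hC' : C * bourgainNorm d₂ s₂ b₂ T₂ ≠ ∞ := ENNReal.mul_ne_top hC h₂.ne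
  rw [bourgainNorm.eq_def d₁ s₁ b₁ T₁, iInf_subtype'] at h₁ ⊢
  refine le_mul_iInf_of_forall_lt_top hC' h₁ fun F hF => ?_
  rw [mul_right_comm]
  exact e₂ F F.2 hF

/-! ### The bilinear estimates -/

section

theorem measurable_enorm_uncurry {F : ℤ → ℝ → ℂ} (hF : ∀ n, Measurable (F n)) :
    Measurable fun z : ℤ × ℝ => ‖F z.1 z.2‖ₑ :=
  measurable_of_forall_int fun n => (hF n).enorm

theorem tsum_lintegral_eq_conv {F G : ℤ → ℝ → ℂ} (hF : ∀ n, Measurable (F n))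
    (hG : ∀ n, Measurable (G n)) (z : ℤ × ℝ) :
    ∑' k : ℤ, ∫⁻ σ, ‖F k σ‖ₑ * ‖G (z.1 - k) (z.2 - σ)‖ₑ
      = conv freqMeasure (fun z => ‖F z.1 z.2‖ₑ) (fun z => ‖G z.1 z.2‖ₑ) z := by
  have hm : Measurable fun x : ℤ × ℝ => ‖F x.1 x.2‖ₑ * ‖G (z - x).1 (z - x).2‖ₑ :=
    (measurable_enorm_uncurry hF).mul
      ((measurable_enorm_uncurry hG).comp (measurable_const.sub measurable_id))
  rw [conv, lintegral_freqMeasure hm]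
  rfl

/-- Conjugation reflects the transform of v, so the convolution for u v̄ is a correlation after
translating the variable by z. -/
theorem tsum_lintegral_eq_corr {F G : ℤ → ℝ → ℂ} (hF : ∀ n, Measurable (F n))
    (hG : ∀ n, Measurable (G n)) (z : ℤ × ℝ) :
    ∑' k : ℤ, ∫⁻ σ, ‖F k σ‖ₑ * ‖(starRingEnd ℂ) (G (-(z.1 - k)) (-(z.2 - σ)))‖ₑ
      = corr freqMeasure (fun z => ‖G z.1 z.2‖ₑ) (fun z => ‖F z.1 z.2‖ₑ) z := by
  have hm : Measurable fun x : ℤ × ℝ => ‖G (x - z).1 (x - z).2‖ₑ * ‖F x.1 x.2‖ₑ :=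
    ((measurable_enorm_uncurry hG).comp (measurable_id.sub measurable_const)).mul
      (measurable_enorm_uncurry hF)
  rw [corr, ← lintegral_sub_right_eq_self _ z]
  simp only [sub_add_cancel]
  rw [lintegral_freqMeasure hm]
  refine tsum_congr fun k => lintegral_congr fun σ => ?_
  rw [RCLike.enorm_conj, neg_sub, neg_sub, mul_comm]
  rfl

theorem rpow_half_sq_bound {D C a b : ℝ≥0∞} :
    (D ^ 2 * (9 * C) * (a * b)) ^ (1 / 2 : ℝ)
      = D * (9 * C) ^ (1 / 2 : ℝ) * a ^ (1 / 2 : ℝ) * b ^ (1 / 2 : ℝ) := by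
  rw [ENNReal.mul_rpow_of_nonneg _ _ (by norm_num), ENNReal.mul_rpow_of_nonneg _ _ (by norm_num),
    ENNReal.mul_rpow_of_nonneg a b (by norm_num), ← ENNReal.rpow_two, ← ENNReal.rpow_mul]
  norm_num
  ring

theorem measurable_freqWeight (disp : ℤ → ℝ) (w : ℤ → ℝ) (b : ℝ) :
    Measurable fun z : ℤ × ℝ => ENNReal.ofReal (w z.1 * japanese (z.2 + disp z.1) ^ b) :=
  measurable_of_forall_int fun n => by
    have h : Measurable fun τ : ℝ => w n * japanese (τ + disp n) ^ b :=
      ((measurable_japanese.comp (measurable_add_const (disp n))).pow_const _).const_mul _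
    exact h.ennreal_ofReal

theorem ofReal_multiplier_le {w R a b p q r : ℝ} (hR : 0 ≤ R) (ha : 0 ≤ a) (hb : 0 ≤ b)
    (hp : 0 ≤ p) (hq : 0 ≤ q) (hr : 0 ≤ r) (h : w ≤ R * (a * b * (p * q + p * r + q * r)))
    (X Y Z : ℝ≥0∞) :
    ENNReal.ofReal w * (X * Y * Z) ≤ ENNReal.ofReal R *
      ((ENNReal.ofReal a * X) * (ENNReal.ofReal b * Y) * Z *
        (ENNReal.ofReal p * ENNReal.ofReal q + ENNReal.ofReal p * ENNReal.ofReal r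
          + ENNReal.ofReal q * ENNReal.ofReal r)) := by
  have h' := ENNReal.ofReal_le_ofReal h
  rw [ENNReal.ofReal_mul hR, ENNReal.ofReal_mul (by positivity), ENNReal.ofReal_mul ha,
    ENNReal.ofReal_add (by positivity) (by positivity), ENNReal.ofReal_add (by positivity)
    (by positivity), ENNReal.ofReal_mul hp, ENNReal.ofReal_mul hp, ENNReal.ofReal_mul hq] at h'
  refine (mul_le_mul' h' le_rfl).trans_eq ?_
  ring

/-- The bilinear estimates, for the Fourier transforms. -/
theorem exists_bilinear_bound {γ : ℝ} (hγ : |γ| ≠ 1) : ∃ C : ℝ≥0∞, C ≠ ∞ ∧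
    ∀ s : ℝ, 1 / 2 ≤ s → ∀ F G : ℤ → ℝ → ℂ, (∀ n, Measurable (F n)) → (∀ n, Measurable (G n)) →
      (∫⁻ z, (ENNReal.ofReal (japanese z.1 ^ s * japanese (z.2 + dispX z.1) ^ (-7 / 16 : ℝ))
        * conv freqMeasure (fun z => ‖F z.1 z.2‖ₑ) (fun z => ‖G z.1 z.2‖ₑ) z) ^ 2
          ∂freqMeasure) ^ (1 / 2 : ℝ)
        ≤ C * weightedNorm (dispY γ) (s - 1 / 2) (1 / 2) F * weightedNorm dispX s (1 / 2) G ∧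
      (∫⁻ z, (ENNReal.ofReal (japanese z.1 * japanese z.1 ^ (s - 1 / 2)
          * japanese (z.2 + dispY γ z.1) ^ (-7 / 16 : ℝ))
        * corr freqMeasure (fun z => ‖G z.1 z.2‖ₑ) (fun z => ‖F z.1 z.2‖ₑ) z) ^ 2
          ∂freqMeasure) ^ (1 / 2 : ℝ)
        ≤ C * weightedNorm dispX s (1 / 2) F * weightedNorm dispX s (1 / 2) G := by
  obtain ⟨K, hK, k1, k2, k3⟩ := exists_kernel_bound hγ
  have hR := resConst_nonneg γ
  refine ⟨ENNReal.ofReal (resConst γ) * (9 * K) ^ (1 / 2 : ℝ),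
    ENNReal.mul_ne_top ENNReal.ofReal_ne_top (ENNReal.rpow_ne_top_of_nonneg (by norm_num)
      (ENNReal.mul_ne_top (by norm_num) hK)), fun s hs F G mF mG => ⟨?_, ?_⟩⟩
  · rw [weightedNorm_eq _ _ _ mF, weightedNorm_eq _ _ _ mG, ← rpow_half_sq_bound]
    refine ENNReal.rpow_le_rpow (lintegral_sq_le_of_forall_pairing _ _ fun h mh => ?_)
      (by norm_num)
    -- The dual function h sits at the output frequency x + y and carries the output weight; the
    -- transforms of u and v sit at x and y.
    have key := sq_trilinear_le_of_le freqMeasure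
      (f₀ := fun z => ‖F z.1 z.2‖ₑ) (g₀ := fun z => ‖G z.1 z.2‖ₑ)
      (h₀ := fun z => ENNReal.ofReal
        (japanese z.1 ^ s * japanese (z.2 + dispX z.1) ^ (-7 / 16 : ℝ)) * h z)
      (measurable_weighted (dispY γ) (s - 1 / 2) (1 / 2) mF)
      (measurable_weighted dispX s (1 / 2) mG) mh (measurable_modWeight (dispY γ))
      (measurable_modWeight dispX) (measurable_modWeight dispX) K
      (ENNReal.ofReal (resConst γ)) k1 k2 k3 (fun x y => ?_)
    · rw [trilinear_eq_conv _ (measurable_enorm_uncurry mF) (measurable_enorm_uncurry mG)] at key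
      · rw [mul_assoc _ _ (∫⁻ z, h z ^ 2 ∂freqMeasure)]
        refine le_trans (le_of_eq ?_) key
        congr 1
        refine lintegral_congr fun z => ?_
        ring
      · exact (measurable_freqWeight dispX (fun n => japanese n ^ s) _).mul mh
    · have hm := multiplier_schrodinger_le (γ := γ) (n₁ := x.1) (n₂ := y.1)
        (σ₁ := x.2 + dispY γ x.1) (σ₂ := y.2 + dispX y.1) (σ := (x + y).2 + dispX (x + y).1) hs hγ
        (by simp only [dispX, dispY, Prod.fst_add, Prod.snd_add]; push_cast; ring)
      have hx := japanese_pos x.1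
      have hy := japanese_pos y.1
      have p1 := japanese_pos (x.2 + dispY γ x.1)
      have p2 := japanese_pos (y.2 + dispX y.1)
      have p3 := japanese_pos ((x + y).2 + dispX (x + y).1)
      have hm' := ofReal_multiplier_le hR (by positivity) (by positivity) (by positivity)
        (by positivity) (by positivity) hm ‖F x.1 x.2‖ₑ ‖G y.1 y.2‖ₑ (h (x + y))
      refine le_trans (le_of_eq ?_) hm'
      simp only [Prod.fst_add, Int.cast_add]
      ring
  · rw [weightedNorm_eq _ _ _ mF, weightedNorm_eq _ _ _ mG, ← rpow_half_sq_bound]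
    refine ENNReal.rpow_le_rpow (lintegral_sq_le_of_forall_pairing _ _ fun h mh => ?_)
      (by norm_num)
    -- The output is now the Benjamin-Ono frequency x, so h takes the first slot. Since x = (x + y)
    -- − y, the transform of v sits at y and that of u at x + y, and the same kernel bounds apply.
    have key := sq_trilinear_le_of_le freqMeasure
      (f₀ := fun z => ENNReal.ofReal (japanese z.1 * japanese z.1 ^ (s - 1 / 2)
        * japanese (z.2 + dispY γ z.1) ^ (-7 / 16 : ℝ)) * h z)
      (g₀ := fun z => ‖G z.1 z.2‖ₑ) (h₀ := fun z => ‖F z.1 z.2‖ₑ) mh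
      (measurable_weighted dispX s (1 / 2) mG) (measurable_weighted dispX s (1 / 2) mF)
      (measurable_modWeight (dispY γ)) (measurable_modWeight dispX) (measurable_modWeight dispX) K
      (ENNReal.ofReal (resConst γ)) k1 k2 k3 (fun x y => ?_)
    · rw [trilinear_eq_corr_fst _ (measurable_enorm_uncurry mG) (measurable_enorm_uncurry mF)]
        at key
      refine le_trans (le_of_eq ?_) (key.trans (le_of_eq ?_))
      · congr 1
        refine lintegral_congr fun z => ?_
        ring
      · ring
    · have hm := multiplier_benjaminOno_le (γ := γ) (n₁ := x.1) (n₂ := y.1)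
        (σ₁ := x.2 + dispY γ x.1) (σ₂ := y.2 + dispX y.1) (σ := (x + y).2 + dispX (x + y).1) hs hγ
        (by simp only [dispX, dispY, Prod.fst_add, Prod.snd_add]; push_cast; ring)
      have hy := japanese_pos y.1
      have hxy := japanese_pos (x.1 + y.1)
      have p1 := japanese_pos (x.2 + dispY γ x.1)
      have p2 := japanese_pos (y.2 + dispX y.1)
      have p3 := japanese_pos ((x + y).2 + dispX (x + y).1)
      have hm' := ofReal_multiplier_le hR (by positivity) (by positivity) (by positivity)
        (by positivity) (by positivity) hm ‖G y.1 y.2‖ₑ ‖F (x + y).1 (x + y).2‖ₑ (h x)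
      refine le_trans (le_of_eq ?_) (hm'.trans (le_of_eq ?_))
      · ring
      · simp only [weighted, modWeight, Prod.fst_add, Int.cast_add]
        ring

/-- The exponent 7/16 = 1/2 − 1/16 determines the range ε ≤ 1/16. -/
theorem rpow_modulation_le {ε : ℝ} (hε : ε ≤ 1 / 16) (x : ℝ) :
    japanese x ^ (-1 / 2 + ε) ≤ japanese x ^ (-7 / 16 : ℝ) :=
  Real.rpow_le_rpow_of_exponent_le (one_le_japanese x) (by linarith)

variable {L : ℝ} [hL : Fact (0 < L)]

theorem normX_mul_le {u v : ℝ × AddCircle L → ℂ} (hu : MemLp u 2) (hv : MemLp v 2)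
    {F G : ℤ → ℝ → ℂ} (hF : HasFourierTransform (ofFun u) F)
    (hG : HasFourierTransform (ofFun v) G) (mF : ∀ n, Measurable (F n))
    (mG : ∀ n, Measurable (G n)) (s : ℝ) {ε : ℝ} (hε : ε ≤ 1 / 16) :
    normX s (-1 / 2 + ε) (ofFun fun p => u p * v p) ≤
      (∫⁻ z, (ENNReal.ofReal (japanese z.1 ^ s * japanese (z.2 + dispX z.1) ^ (-7 / 16 : ℝ))
        * conv freqMeasure (fun z => ‖F z.1 z.2‖ₑ) (fun z => ‖G z.1 z.2‖ₑ) z) ^ 2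
          ∂freqMeasure) ^ (1 / 2 : ℝ) := by
  have hint : Integrable (fun p => u p * v p) := hu.integrable_mul hv
  refine (iInf₂_le _ (hasFourierTransform_fourierIntegral hint)).trans
    (weightedNorm_le _ _ _ ?_ fun z => ?_)
  · exact (measurable_freqWeight dispX (fun n => japanese n ^ s) _).mul
      (measurable_conv _ (measurable_enorm_uncurry mF) (measurable_enorm_uncurry mG))
  · have h := enorm_fourierIntegral_mul_le hu hv hF hG z.1 z.2
    rw [tsum_lintegral_eq_conv mF mG] at h
    have h1 := japanese_pos z.1
    refine mul_le_mul' (ENNReal.ofReal_le_ofReal ?_) h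
    exact mul_le_mul_of_nonneg_left (rpow_modulation_le hε _) (by positivity)

theorem normY_dx_mul_conj_le {u v : ℝ × AddCircle L → ℂ} (hu : MemLp u 2) (hv : MemLp v 2)
    {F G : ℤ → ℝ → ℂ} (hF : HasFourierTransform (ofFun u) F)
    (hG : HasFourierTransform (ofFun v) G) (mF : ∀ n, Measurable (F n))
    (mG : ∀ n, Measurable (G n)) (γ s : ℝ) {ε : ℝ} (hε : ε ≤ 1 / 16) :
    normY γ (s - 1 / 2) (-1 / 2 + ε) (ofFun fun p => u p * (starRingEnd ℂ) (v p)).dx ≤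
      ENNReal.ofReal (2 * Real.pi / L) *
      (∫⁻ z, (ENNReal.ofReal (japanese z.1 * japanese z.1 ^ (s - 1 / 2)
          * japanese (z.2 + dispY γ z.1) ^ (-7 / 16 : ℝ))
        * corr freqMeasure (fun z => ‖G z.1 z.2‖ₑ) (fun z => ‖F z.1 z.2‖ₑ) z) ^ 2
          ∂freqMeasure) ^ (1 / 2 : ℝ) := by
  have hv' : MemLp (fun p => (starRingEnd ℂ) (v p)) 2 := hv.star
  have hint : Integrable (fun p => u p * (starRingEnd ℂ) (v p)) := hu.integrable_mul hv'
  have hL0 := hL.out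
  set k : ℤ × ℝ → ℝ≥0∞ := fun z => ENNReal.ofReal (japanese z.1 * japanese z.1 ^ (s - 1 / 2)
      * japanese (z.2 + dispY γ z.1) ^ (-7 / 16 : ℝ))
    * corr freqMeasure (fun z => ‖G z.1 z.2‖ₑ) (fun z => ‖F z.1 z.2‖ₑ) z with hk
  have mk : Measurable k :=
    (measurable_freqWeight (dispY γ) (fun n => japanese n * japanese n ^ (s - 1 / 2)) _).mul
      (measurable_corr _ (measurable_enorm_uncurry mG) (measurable_enorm_uncurry mF))
  have hscale : ENNReal.ofReal (2 * Real.pi / L) * (∫⁻ z, k z ^ 2 ∂freqMeasure) ^ (1 / 2 : ℝ)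
      = (∫⁻ z, (ENNReal.ofReal (2 * Real.pi / L) * k z) ^ 2 ∂freqMeasure) ^ (1 / 2 : ℝ) := by
    simp only [mul_pow]
    rw [lintegral_const_mul _ (mk.pow_const 2), ENNReal.mul_rpow_of_nonneg _ _ (by norm_num),
      ← ENNReal.rpow_two, ← ENNReal.rpow_mul]
    norm_num
  rw [hscale]
  refine (iInf₂_le _ (hasFourierTransform_fourierIntegral hint).dx).trans
    (weightedNorm_le _ _ _ (mk.const_mul _) fun z => ?_)
  have h := enorm_fourierIntegral_mul_le hu hv' hF hG.conj z.1 z.2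
  rw [tsum_lintegral_eq_corr mF mG] at h
  have h1 := japanese_pos z.1
  -- The symbol of ∂ₓ is the only place where the period enters the estimate.
  have e : ‖(2 * Real.pi * Complex.I * z.1 / L : ℂ)‖ₑ
      ≤ ENNReal.ofReal (2 * Real.pi / L) * ENNReal.ofReal (japanese z.1) := by
    rw [← ofReal_norm, ← ENNReal.ofReal_mul (by positivity)]
    refine ENNReal.ofReal_le_ofReal ?_
    have e1 : ‖(2 * Real.pi * Complex.I * z.1 / L : ℂ)‖ = 2 * Real.pi / L * |(z.1 : ℝ)| := by
      simp only [norm_div, norm_mul, Complex.norm_real, Complex.norm_I, Complex.norm_intCast,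
        Complex.norm_ofNat, Real.norm_eq_abs, abs_of_pos hL0, abs_of_pos Real.pi_pos]
      ring
    rw [e1]
    gcongr
    simp [japanese]
  have hw : ENNReal.ofReal (japanese z.1 ^ (s - 1 / 2)
      * japanese (z.2 + dispY γ z.1) ^ (-1 / 2 + ε))
      ≤ ENNReal.ofReal (japanese z.1 ^ (s - 1 / 2)
      * japanese (z.2 + dispY γ z.1) ^ (-7 / 16 : ℝ)) := by
    refine ENNReal.ofReal_le_ofReal ?_
    exact mul_le_mul_of_nonneg_left (rpow_modulation_le hε _) (by positivity)
  rw [weighted, enorm_mul]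
  refine (mul_le_mul' hw (mul_le_mul' e h)).trans_eq ?_
  rw [hk]
  simp only
  rw [mul_assoc (japanese (z.1 : ℝ)), ENNReal.ofReal_mul h1.le]
  ring

end

end Bourgain

end

theorem proposition3 :
    ∃ ε₀ : ℝ, 0 < ε₀ ∧
      ∀ (L : ℝ) [Fact (0 < L)] (γ : ℝ), γ ≠ 0 → |γ| ≠ 1 →
        ∃ C : ℝ, 0 < C ∧
          ∀ s : ℝ, 1 / 2 ≤ s → ∀ ε : ℝ, 0 < ε → ε ≤ ε₀ →
            (∀ u v : ℝ × AddCircle L → ℂ,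
              MemLp u 2 volume → MemLp v 2 volume →
              Bourgain.normY γ (s - 1 / 2) (1 / 2) (Bourgain.ofFun u) < ∞ →
              Bourgain.normX s (1 / 2) (Bourgain.ofFun v) < ∞ →
              Bourgain.normX s (-1 / 2 + ε) (Bourgain.ofFun (fun p => u p * v p)) ≤
                ENNReal.ofReal C *
                  Bourgain.normY γ (s - 1 / 2) (1 / 2) (Bourgain.ofFun u) *
                  Bourgain.normX s (1 / 2) (Bourgain.ofFun v)) ∧
            (∀ u v : ℝ × AddCircle L → ℂ,
              MemLp u 2 volume → MemLp v 2 volume →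
              Bourgain.normX s (1 / 2) (Bourgain.ofFun u) < ∞ →
              Bourgain.normX s (1 / 2) (Bourgain.ofFun v) < ∞ →
              Bourgain.normY γ (s - 1 / 2) (-1 / 2 + ε)
                  (Bourgain.ofFun (fun p => u p * (starRingEnd ℂ) (v p))).dx ≤
                ENNReal.ofReal C *
                  Bourgain.normX s (1 / 2) (Bourgain.ofFun u) *
                  Bourgain.normX s (1 / 2) (Bourgain.ofFun v)) := by
  refine ⟨1 / 16, by norm_num, fun L hL γ _ hγ => ?_⟩
  obtain ⟨K, hK, hbound⟩ := Bourgain.exists_bilinear_bound hγ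
  have hL0 : 0 < L := hL.out
  have hpi : 0 < 2 * Real.pi / L := div_pos Real.two_pi_pos hL0
  -- The constant dominates both K, for the product, and (2π/L) K, for the derivative; K depends on
  -- γ only, and adding 1 ensures positivity.
  have hC1 : K ≤ ENNReal.ofReal ((1 + 2 * Real.pi / L) * (K.toReal + 1)) := by
    rw [ENNReal.le_ofReal_iff_toReal_le hK (by positivity)]
    nlinarith [ENNReal.toReal_nonneg (a := K)]
  have hC2 : ENNReal.ofReal (2 * Real.pi / L) * K
      ≤ ENNReal.ofReal ((1 + 2 * Real.pi / L) * (K.toReal + 1)) := by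
    rw [ENNReal.le_ofReal_iff_toReal_le (ENNReal.mul_ne_top ENNReal.ofReal_ne_top hK)
      (by positivity), ENNReal.toReal_mul, ENNReal.toReal_ofReal hpi.le]
    nlinarith [ENNReal.toReal_nonneg (a := K)]
  refine ⟨(1 + 2 * Real.pi / L) * (K.toReal + 1), by positivity, fun s hs ε _ hε =>
    ⟨fun u v hu hv nu nv => ?_, fun u v hu hv nu nv => ?_⟩⟩
  · refine Bourgain.le_mul_bourgainNorm ENNReal.ofReal_ne_top nu nv fun F G hF hG mF mG => ?_
    refine (Bourgain.normX_mul_le hu hv hF hG mF mG s hε).trans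
      ((hbound s hs F G mF mG).1.trans ?_)
    gcongr
  · refine Bourgain.le_mul_bourgainNorm ENNReal.ofReal_ne_top nu nv fun F G hF hG mF mG => ?_
    refine (Bourgain.normY_dx_mul_conj_le hu hv hF hG mF mG γ s hε).trans
      ((mul_le_mul' le_rfl (hbound s hs F G mF mG).2).trans ?_)
    rw [← mul_assoc, ← mul_assoc]
    gcongr
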